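/- Fix $b>0$ and $p\in(0,1)$. Let $\mathcal B_p$ be the law on $\{\pm1\}^N$ with independent coordinates equal to $1$ with probability $p$; call $x'$ $\rho$-correlated to $x$ if, independently over $i$, a coordinate $x_i=1$ is flipped with probability $(1-p)(1-\rho)$ and a coordinate $x_i=-1$ with probability $p(1-\rho)$. *Training.* A training procedure maps a subset $x\in\{\pm1\}^N$ of a data set of size $N$ and a random seed $r$ to a model $\mathrm{train}(x,r)$. Every model $\theta$ has an output in $[-b,b]$, and the output of $\mathrm{train}(x,r)$ is $f(x)$, where $f:\{\pm1\}^N\to[-b,b]$ is the model output function. A reflexive equivalence check $\mathrm{CheckEquiv}(\theta,\theta')$ accepts only pairs of models of equal output. *Attribution.* For scores $a=(\theta_0,\theta)\in\mathbb R\times\mathbb R^N$ let $\mathrm{mse}(a)=\mathbb E_{x\sim\mathcal B_p}\big[(f(x)-\theta_0-\langle\theta,x\rangle)^2\big]$, let $\Phi$ be a minimizer of $\mathrm{mse}$, and $\mathrm{err}(a)=\mathrm{mse}(a)-\mathrm{mse}(\Phi)$. *Protocol* with parameters $\rho,n,k,m$ and accuracy $\varepsilon$. 1. The verifier draws $m$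 points $z_1,\dots,z_m\sim\mathcal B_p$; for each $\rho'\in\{0,\rho,2\rho\}$ it draws $n$ pairs $(x,x')$ with $x\sim\mathcal B_p$ and $x'$ $\rho'$-correlated to $x$; it draws $n$ further points from $\mathcal B_p$. The resulting list of $7n$ points (with repetitions), with a random seed for each entry, is sent to the prover. The verifier secretly chooses a uniformly random set of $\min(k,7n)$ entries of the list. 2. The prover replies with a model for each entry and with scores $a$. The honest prover sends the models trained on the given points and seeds, and $a=\Phi$. 3. The verifier retrains the models of the chosen entries one after the other, and aborts if one of them is not equivalent to the model received. Otherwise let $v$ denote the outputs of the received models; let $\hat y_{\rho'}$ be the average of the products of $v$ over the pairs at level $\rho'$, let $\hat B$ be the average of $v^2$ over the $n$ further points, and let $(\hat B_0,\hat B_1,\hat B_2)$ minimize $\sum_{\rho'\in\{0,\rho,2\rho\}}(B_0+B_1\rho'+B_2\rho'^2-\hat y_{\rho'})^2$ over $B_0,B_1,B_2\ge0$. Put $\hat B_{\ge2}=\hat B-\hat B_0-\hat B_1$. The verifier trains a model with a fresh seed on each $z_j$, computes the empirical mean squared error $\widehat{\mathrm{mse}}(a)$ on these $m$ points, and aborts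 if $\widehat{\mathrm{mse}}(a)>\hat B_{\ge2}+\varepsilon/2$; otherwise it outputs $a$. **Theorem.** There are constants $c_\rho\in(0,\tfrac12]$, $c_E,c_C,c_M,C>0$, an integer $K\ge1$ and a function $\kappa:(0,1)^2\to\mathbb N$, all depending only on $b$ and $p$, such that for all $\varepsilon,\delta\in(0,1)$ the two-message protocol with $\rho=c_\rho\sqrt\varepsilon$, $n=\lceil c_E\log(4/\delta)/\varepsilon^3\rceil$, $k=\lceil c_C\log(4/\delta)/\varepsilon^2\rceil$, $m=\lceil c_M\log(4/\delta)/\varepsilon^2\rceil$ is an $(\varepsilon,\delta)$-PAC verifier for $\Phi$: for every $N$, every $f:\{\pm1\}^N\to[-b,b]$ and every training procedure as above, a minimizer $\Phi$ exists and * (completeness) with the honest prover, $\Pr[\text{the verifier outputs some } a \text{ with } \mathrm{err}(a)\le\varepsilon]\ge1-\delta$; * (soundness) with any, computationally unbounded and possibly randomized, prover, $\Pr[\text{the verifier outputs some } a \text{ with } \mathrm{err}(a)>\varepsilon]\le\delta$; * (cost) with any prover, the expected number of trainings by the verifier is at most $\kappa(\varepsilon,\delta)$. Moreover $\kappa(\varepsilon,\delta)\le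 C\log(4/\delta)/\varepsilon^2$ for all $\varepsilon,\delta\in(0,1)$, and $\kappa(\varepsilon,\delta)\le C\log(1/\delta)/\varepsilon^2$ if moreover $\delta\le\tfrac12$; and $\kappa(\varepsilon,\delta)<\big(\tfrac1\varepsilon\log\tfrac1\delta\big)^{K}$ for all $\varepsilon,\delta\in(0,\tfrac12]$. -/

import Mathlib

open scoped ENNReal

noncomputable section

namespace Attribution

/-! ### Discrete product laws -/

theorem tsum_fin_prod {α : Type*} (n : ℕ) (μ : Fin n → PMF α) :
    ∑' x : Fin n → α, ∏ i, μ i (x i) = 1 := by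
  induction n with
  | zero => simp [tsum_fintype]
  | succ n ih =>
    rw [← (Fin.consEquiv (fun _ : Fin (n + 1) => α)).tsum_eq
      (fun x : Fin (n + 1) → α => ∏ i, μ i (x i)), ENNReal.tsum_prod']
    simp only [Fin.consEquiv, Equiv.coe_fn_mk, Fin.prod_univ_succ, Fin.cons_zero, Fin.cons_succ,
      ENNReal.tsum_mul_left]
    rw [ENNReal.tsum_mul_right, PMF.tsum_coe, one_mul]
    exact ih (fun i => μ i.succ)

theorem tsum_pi_prod {ι α : Type*} [Fintype ι] (μ : ι → PMF α) :
    ∑' x : ι → α, ∏ i, μ i (x i) = 1 := by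
  have e := Fintype.equivFin ι
  rw [← (Equiv.arrowCongr e.symm (Equiv.refl α)).tsum_eq
    (fun x : ι → α => ∏ i, μ i (x i)), ← tsum_fin_prod _ (fun j => μ (e.symm j))]
  refine tsum_congr fun x => ?_
  refine Fintype.prod_equiv e _ _ fun i => ?_
  simp [Equiv.arrowCongr]

/-- The joint law of independent draws, the `i`-th one from `μ i`. -/
def productLaw {ι α : Type*} [Fintype ι] (μ : ι → PMF α) : PMF (ι → α) :=
  ⟨fun x => ∏ i, μ i (x i), by
    rw [← tsum_pi_prod μ]; exact ENNReal.summable.hasSum⟩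

/-! ### The `p`-biased cube -/

/-- The cube `{±1}^N`; the point `x` encodes the subset `{i | x i = 1}` of the training set. -/
abbrev Cube (N : ℕ) := Fin N → ℤˣ

/-- The random sign equal to `1` with probability `q` and to `-1` with probability `1 - q`
(for `q ∈ [0,1]`; other values of `q` are clamped to that interval). -/
def signLaw (q : ℝ) : PMF ℤˣ :=
  PMF.ofFintype
    (fun u => if u = 1 then min 1 (ENNReal.ofReal q) else 1 - min 1 (ENNReal.ofReal q)) (by
      have h : (Finset.univ : Finset ℤˣ) = {1, -1} := rfl
      have h' : ¬ ((-1 : ℤˣ) = 1) := by decide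
      rw [h, Finset.sum_pair (by decide)]
      simp only [if_true, if_neg h']
      exact add_tsub_cancel_of_le (min_le_left _ _))

/-- The `p`-biased distribution `B_p` on `{±1}^N`. -/
def biasedLaw (p : ℝ) (N : ℕ) : PMF (Cube N) :=
  productLaw fun _ => signLaw p

/-- The law of a point `ρ`-correlated to `x`: independently in each coordinate, a `1` is flipped
with probability `(1 - p) (1 - ρ)` and a `-1` is flipped with probability `p (1 - ρ)`. -/
def correlatedLaw (p ρ : ℝ) {N : ℕ} (x : Cube N) : PMF (Cube N) :=
  productLaw fun i =>
    if x i = 1 then signLaw (1 - (1 - p) * (1 - ρ)) else signLaw (p * (1 - ρ))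

/-- The law of a pair `(x, x')` with `x ∼ B_p` and `x'` being `ρ`-correlated to `x`. -/
def correlatedPairLaw (p ρ : ℝ) (N : ℕ) : PMF (Cube N × Cube N) :=
  (biasedLaw p N).bind fun x => (correlatedLaw p ρ x).map fun x' => (x, x')

/-! ### Linear attributions and their error -/

/-- Attribution scores: the coefficients of a linear datamodel with its intercept. -/
structure Scores (N : ℕ) where
  intercept : ℝ
  weights : Fin N → ℝ

/-- The linear datamodel `x ↦ θ₀ + ∑ i, θ i * x i`. -/
def Scores.predict {N : ℕ} (a : Scores N) (x : Cube N) : ℝ :=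
  a.intercept + ∑ i, a.weights i * ((x i : ℤ) : ℝ)

/-- The mean squared error of the datamodel `a` for `f` under `B_p`. -/
def mse (p : ℝ) {N : ℕ} (f : Cube N → ℝ) (a : Scores N) : ℝ :=
  ∑ x : Cube N, (biasedLaw p N x).toReal * (f x - a.predict x) ^ 2

/-- `a` minimizes the mean squared error. -/
def IsOptimal (p : ℝ) {N : ℕ} (f : Cube N → ℝ) (a : Scores N) : Prop :=
  ∀ a' : Scores N, mse p f a ≤ mse p f a'

instance (N : ℕ) : Nonempty (Scores N) := ⟨⟨0, 0⟩⟩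

/-- The optimal attribution `Φ`, a minimizer of the mean squared error. -/
def optimalScores (p : ℝ) {N : ℕ} (f : Cube N → ℝ) : Scores N :=
  Classical.epsilon (IsOptimal p f)

/-- The error of `a`: its gap to the optimal mean squared error. -/
def err (p : ℝ) {N : ℕ} (f : Cube N → ℝ) (a : Scores N) : ℝ :=
  mse p f a - mse p f (optimalScores p f)

/-! ### Verifiers that train models, and two-message protocols -/

/-- A computation that may request model trainings. A request `q` is answered by the trained
model, on which the rest of the computation may depend; `α` is the type of its result. -/
inductive TrainingProgram (Q Θ α : Type*) where
  | done (result : α) : TrainingProgram Q Θ α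
  | train (q : Q) (next : Θ → TrainingProgram Q Θ α) : TrainingProgram Q Θ α

/-- The result of a computation together with the number of trainings that it performed. -/
def TrainingProgram.run {Q Θ α : Type*} (train : Q → Θ) : TrainingProgram Q Θ α → α × ℕ
  | .done result => (result, 0)
  | .train q next =>
    let r := TrainingProgram.run train (next (train q))
    (r.1, r.2 + 1)

/-- Train one model for each of the `m` requests in `q`, then continue with these models. -/
def TrainingProgram.trainAll {Q Θ α : Type*} :
    (m : ℕ) → (Fin m → Q) → ((Fin m → Θ) → TrainingProgram Q Θ α) → TrainingProgram Q Θ α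
  | 0, _, next => next Fin.elim0
  | m + 1, q, next =>
    .train (q 0) fun θ =>
      TrainingProgram.trainAll m (fun i => q i.succ) fun θs => next (Fin.cons θ θs)

/-- A verifier of a two-message protocol. It tosses its coins, sends `message` to the prover and
keeps `secret`; after the reply of the prover it performs a computation that can train models on
subsets and seeds of its choice and that outputs scores, or `none` for abort. -/
structure Verifier (N : ℕ) (Seed Θ Msg Secret Reply : Type*) where
  coins : PMF (Msg × Secret)
  decide : Msg → Secret → Reply → TrainingProgram (Cube N × Seed) Θ (Option (Scores N))

/-- A (possibly randomized) prover of a two-message protocol: an arbitrary map, without any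
bound on its computational power. -/
abbrev Prover (Msg Reply : Type*) := Msg → PMF Reply

section Protocol

variable {N : ℕ} {Seed Θ Msg Secret Reply : Type*}

/-- The joint law of the verifier's output and of the number of its trainings. -/
def interact (train : Cube N → Seed → Θ) (V : Verifier N Seed Θ Msg Secret Reply)
    (P : Prover Msg Reply) : PMF (Option (Scores N) × ℕ) :=
  V.coins.bind fun c => (P c.1).map fun r =>
    (V.decide c.1 c.2 r).run fun q => train q.1 q.2

/-- The expected number of trainings performed by the verifier. -/
def expectedTrainings (train : Cube N → Seed → Θ) (V : Verifier N Seed Θ Msg Secret Reply)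
    (P : Prover Msg Reply) : ℝ≥0∞ :=
  ∑' o, interact train V P o * (o.2 : ℝ≥0∞)

/-- Completeness, soundness and verifier cost of the pair `(V, P)` for the training procedure
`train` with model output function `f`. -/
structure IsPACVerifier (p ε δ : ℝ) (κ : ℝ → ℝ → ℕ) (f : Cube N → ℝ)
    (train : Cube N → Seed → Θ) (V : Verifier N Seed Θ Msg Secret Reply)
    (P : Prover Msg Reply) : Prop where
  complete : ENNReal.ofReal (1 - δ) ≤
    (interact train V P).toOuterMeasure {o | ∃ a, o.1 = some a ∧ err p f a ≤ ε}
  sound : ∀ P' : Prover Msg Reply,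
    (interact train V P').toOuterMeasure {o | ∃ a, o.1 = some a ∧ ε < err p f a}
      ≤ ENNReal.ofReal δ
  cost : ∀ P' : Prover Msg Reply, expectedTrainings train V P' ≤ (κ ε δ : ℝ≥0∞)

end Protocol

/-! ### Residual estimation -/

/-- The squared residual `‖A z - y‖²` of the quadratic fit at the noise levels `0, ρ, 2ρ`. -/
def fitLoss (ρ : ℝ) (y z : Fin 3 → ℝ) : ℝ :=
  ∑ i, (Matrix.mulVec !![1, 0, 0; 1, ρ, ρ ^ 2; 1, 2 * ρ, 4 * ρ ^ 2] z i - y i) ^ 2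

/-- The solution of the non-negative least squares problem `min_{z ≥ 0} ‖A z - y‖²`. -/
def nonnegFit (ρ : ℝ) (y : Fin 3 → ℝ) : Fin 3 → ℝ :=
  Classical.epsilon fun z => 0 ≤ z ∧ ∀ w, 0 ≤ w → fitLoss ρ y z ≤ fitLoss ρ y w

/-- The function evaluations needed for the residual estimate with `n` samples per noise level:
`inl (j, e, s)` is the first (`s = false`) or second (`s = true`) point of the `e`-th pair at the
`j`-th of the noise levels `0, ρ, 2ρ`, and `inr e` is the `e`-th point for noise level `1`. -/
abbrev Slot (n : ℕ) := (Fin 3 × Fin n × Bool) ⊕ Fin n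

/-- The residual estimate computed from the function values `v` at all evaluation points. -/
def residualEstimate (ρ : ℝ) (n : ℕ) (v : Slot n → ℝ) : ℝ :=
  let y : Fin 3 → ℝ := fun j =>
    (∑ e : Fin n, v (.inl (j, e, false)) * v (.inl (j, e, true))) / n
  let B : ℝ := (∑ e : Fin n, v (.inr e) ^ 2) / n
  B - nonnegFit ρ y 0 - nonnegFit ρ y 1

/-! ### The spot-checking protocol -/

/-- What both parties know about models: `Θ` is the type of (weights of) models and `Seed` the
type of training seeds. The model output is read off the model and lies in `[-b, b]`. The
equivalence check accepts a reproduced training, and identifies only models of equal output. -/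
structure ModelClass (Seed Θ : Type*) (b : ℝ) where
  seedLaw : PMF Seed
  output : Θ → ℝ
  output_mem : ∀ θ, output θ ∈ Set.Icc (-b) b
  checkEquiv : Θ → Θ → Prop
  checkEquiv_refl : ∀ θ, checkEquiv θ θ
  output_eq_of_checkEquiv : ∀ θ θ', checkEquiv θ θ' → output θ = output θ'

/-- The parameters of the protocol: the noise level, the number of samples per noise level, the
number of spot-checks and the number of samples for the error estimate. -/
structure Parameters where
  ρ : ℝ
  n : ℕ
  k : ℕ
  m : ℕ

/-- The first message: the evaluation points for the residual estimate and a seed for each. -/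
structure Challenge (N n : ℕ) (Seed : Type*) where
  pairs : Fin 3 × Fin n → Cube N × Cube N
  singles : Fin n → Cube N
  seeds : Slot n → Seed

/-- The subset to train on in a given slot. -/
def Challenge.subset {N n : ℕ} {Seed : Type*} (c : Challenge N n Seed) : Slot n → Cube N
  | .inl (j, e, false) => (c.pairs (j, e)).1
  | .inl (j, e, true) => (c.pairs (j, e)).2
  | .inr e => c.singles e

/-- What the verifier keeps secret: the slots to spot-check, and the subsets and fresh seeds for
its own estimate of the mean squared error. -/
structure Secret (N n m : ℕ) (Seed : Type*) where
  spots : Finset (Slot n)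
  points : Fin m → Cube N
  seeds : Fin m → Seed

/-- The second message: a model for each slot, and the attribution scores. -/
structure Reply (N n : ℕ) (Θ : Type*) where
  models : Slot n → Θ
  scores : Scores N

/-- A uniformly random set of `k` slots (of all slots if there are fewer than `k`). -/
def spotLaw (n k : ℕ) : PMF (Finset (Slot n)) :=
  PMF.uniformOfFinset
    (Finset.powersetCard (min k (Fintype.card (Slot n))) Finset.univ)
    (Finset.powersetCard_nonempty.2 (by rw [Finset.card_univ]; exact min_le_right _ _))

section SpotCheck

variable {Seed Θ : Type*} {b : ℝ}

/-- The law of the verifier's message and secret. -/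
def verifierCoins (M : ModelClass Seed Θ b) (p : ℝ) (N : ℕ) (π : Parameters) :
    PMF (Challenge N π.n Seed × Secret N π.n π.m Seed) :=
  (productLaw fun _ : Fin π.m => biasedLaw p N).bind fun points =>
  (productLaw fun s : Fin 3 × Fin π.n =>
    correlatedPairLaw p (![0, π.ρ, 2 * π.ρ] s.1) N).bind fun pairs =>
  (productLaw fun _ : Fin π.n => biasedLaw p N).bind fun singles =>
  (productLaw fun _ : Slot π.n => M.seedLaw).bind fun seeds =>
  (spotLaw π.n π.k).bind fun spots =>
  (productLaw fun _ : Fin π.m => M.seedLaw).map fun freshSeeds =>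
    (⟨pairs, singles, seeds⟩, ⟨spots, points, freshSeeds⟩)

open Classical in
/-- Retrain the models of the listed slots and abort at the first one that is not equivalent to
the model received from the prover; if all checks pass, continue with `next`. -/
def spotCheck (M : ModelClass Seed Θ b) {N n : ℕ} (c : Challenge N n Seed) (models : Slot n → Θ)
    (next : TrainingProgram (Cube N × Seed) Θ (Option (Scores N))) :
    List (Slot n) → TrainingProgram (Cube N × Seed) Θ (Option (Scores N))
  | [] => next
  | s :: l => .train (c.subset s, c.seeds s) fun θ =>
      if M.checkEquiv θ (models s) then spotCheck M c models next l else .done none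

open Classical in
/-- The verifier's part after the reply: spot-check, estimate the residual from the received
models, estimate the mean squared error of the received scores from own trainings, compare. -/
def verifierDecide (M : ModelClass Seed Θ b) (ε : ℝ) (N : ℕ) (π : Parameters)
    (c : Challenge N π.n Seed) (s : Secret N π.n π.m Seed) (r : Reply N π.n Θ) :
    TrainingProgram (Cube N × Seed) Θ (Option (Scores N)) :=
  spotCheck M c r.models
    (TrainingProgram.trainAll π.m (fun j => (s.points j, s.seeds j)) fun θs =>
      let residual := residualEstimate π.ρ π.n fun t => M.output (r.models t)
      let estimate := (∑ j, (M.output (θs j) - r.scores.predict (s.points j)) ^ 2) / π.m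
      if residual + ε / 2 < estimate then .done none else .done (some r.scores))
    s.spots.toList

/-- The verifier of the spot-checking protocol. It has access to the model output function only
through the trainings that it performs and through the models sent by the prover. -/
def spotCheckVerifier (M : ModelClass Seed Θ b) (p ε : ℝ) (N : ℕ) (π : Parameters) :
    Verifier N Seed Θ (Challenge N π.n Seed) (Secret N π.n π.m Seed) (Reply N π.n Θ) where
  coins := verifierCoins M p N π
  decide := verifierDecide M ε N π

/-- The honest prover trains all requested models and sends the optimal scores. -/
def honestProver (p : ℝ) {N : ℕ} (n : ℕ) (f : Cube N → ℝ) (train : Cube N → Seed → Θ) :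
    Prover (Challenge N n Seed) (Reply N n Θ) :=
  fun c => PMF.pure ⟨fun s => train (c.subset s) (c.seeds s), optimalScores p f⟩

end SpotCheck

/-- The parameters for accuracy `ε` and confidence `δ`: `ρ = Θ(√ε)`, of order
`log(4/δ) / ε³` samples for the residual estimate, and of order `log(4/δ) / ε²` spot-checks and
samples for the error estimate. -/
def parameters (cρ cE cC cM ε δ : ℝ) : Parameters where
  ρ := cρ * √ε
  n := ⌈cE * Real.log (4 / δ) / ε ^ 3⌉₊
  k := ⌈cC * Real.log (4 / δ) / ε ^ 2⌉₊
  m := ⌈cM * Real.log (4 / δ) / ε ^ 2⌉₊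

end Attribution

end

/-! The centred coordinates are orthogonal under the biased law. Completing the square (`mse_eq`)
writes the mean squared error of any scores as `residual p f`, the second moment of `f` carried by
sets of at least two coordinates, plus a squared distance that vanishes at the optimum.
Near-optimality of scores is thus certified by two numbers: their mean squared error and the
residual.

The residual is read off from noise stability. For correlated pairs, `E f(x) f(x') = ∑ ρ^|S| W_S`
(`expect_correlatedPairLaw`), which is quadratic in `ρ` up to `ρ³ b²`. Its values at `0, ρ, 2ρ`
determine the weights of levels 0 and 1 with noise amplified by `1/ρ` (`abs_nonnegFit_sub_le`). With
`ρ ~ √ε` the truncation costs order `ε`, and each average must be accurate to order `ε ρ ~ ε^(3/2)`;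
hence `n ~ ε⁻³`. These evaluations are delegated to the prover. The averages tolerate a fraction of
order `ε^(3/2)` of wrong outputs, and a larger fraction is caught by the spot-checks
(`spotLaw_disjoint_le`).

The squared loss has no bound uniform in `N` and in the scores, but two one-sided tails suffice.
Soundness needs that the empirical loss of bad scores is not too small: for a nonnegative variable a
second moment is enough (`lower_tail_of_nonneg`), and the resulting rate is uniform in the size of
the scores (`empirical_loss_lower_tail`). Completeness needs an upper tail only for the optimal
scores, whose loss has a bounded exponential moment (`expect_exp_optimal_loss_le`).

Adaptivity of the prover is harmless. The deviation events of the challenge involve only `f` and the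
sampled points, while spots, test points and fresh seeds are independent of the message and may be
drawn after the reply (`interact_spotCheckVerifier_eq`). The acceptance slack `ε/2` exceeds the
residual error `ε/4` by `ε/4`, which is the room for the honest empirical loss; bad scores exceed
the residual by at least `3ε/4` empirically. -/

noncomputable section

namespace Attribution

/-! ### Expectations under finite laws -/

/-- The expectation of a real function under a law on a finite type. -/
def expect {α : Type*} [Fintype α] (μ : PMF α) (g : α → ℝ) : ℝ := ∑ a, (μ a).toReal * g a

theorem productLaw_toReal {ι α : Type*} [Fintype ι] (μ : ι → PMF α) (x : ι → α) :
    (productLaw μ x).toReal = ∏ i, (μ i (x i)).toReal :=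
  ENNReal.toReal_prod _ _

section Expect

variable {α : Type*} [Fintype α] (μ : PMF α)

theorem sum_toReal : ∑ a, (μ a).toReal = 1 := by
  have h := μ.tsum_coe
  rw [tsum_fintype] at h
  rw [← ENNReal.toReal_sum fun a _ => μ.apply_ne_top a, h, ENNReal.toReal_one]

theorem expect_const (c : ℝ) : expect μ (fun _ => c) = c := by
  rw [expect, ← Finset.sum_mul, sum_toReal, one_mul]

theorem expect_add (g h : α → ℝ) :
    expect μ (fun a => g a + h a) = expect μ g + expect μ h := by
  simp [expect, mul_add, Finset.sum_add_distrib]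

theorem expect_sub (g h : α → ℝ) :
    expect μ (fun a => g a - h a) = expect μ g - expect μ h := by
  simp [expect, mul_sub, Finset.sum_sub_distrib]

theorem expect_const_mul (c : ℝ) (g : α → ℝ) :
    expect μ (fun a => c * g a) = c * expect μ g := by
  simp only [expect, Finset.mul_sum]
  exact Finset.sum_congr rfl fun a _ => by ring

theorem expect_sum {κ : Type*} (s : Finset κ) (g : κ → α → ℝ) :
    expect μ (fun a => ∑ i ∈ s, g i a) = ∑ i ∈ s, expect μ (g i) := by
  simp only [expect, Finset.mul_sum]
  exact Finset.sum_comm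

variable {μ} in
theorem expect_mono {g h : α → ℝ} (hgh : ∀ a, g a ≤ h a) : expect μ g ≤ expect μ h :=
  Finset.sum_le_sum fun a _ => mul_le_mul_of_nonneg_left (hgh a) ENNReal.toReal_nonneg

theorem expect_nonneg {g : α → ℝ} (hg : ∀ a, 0 ≤ g a) : 0 ≤ expect μ g :=
  Finset.sum_nonneg fun a _ => mul_nonneg ENNReal.toReal_nonneg (hg a)

theorem expect_le_const {g : α → ℝ} {c : ℝ} (hg : ∀ a, g a ≤ c) : expect μ g ≤ c :=
  (expect_mono hg).trans_eq (expect_const μ c)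

theorem markov_inequality {g : α → ℝ} (hg : ∀ a, 0 ≤ g a) {s : Set α} (hs : ∀ a ∈ s, 1 ≤ g a) :
    μ.toOuterMeasure s ≤ ENNReal.ofReal (expect μ g) := by
  rw [PMF.toOuterMeasure_apply, tsum_fintype, expect,
    ENNReal.ofReal_sum_of_nonneg fun a _ => mul_nonneg ENNReal.toReal_nonneg (hg a)]
  refine Finset.sum_le_sum fun a _ => ?_
  by_cases ha : a ∈ s
  · rw [Set.indicator_of_mem ha, ENNReal.ofReal_mul ENNReal.toReal_nonneg,
      ENNReal.ofReal_toReal (μ.apply_ne_top a)]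
    exact le_mul_of_one_le_right' (ENNReal.one_le_ofReal.2 (hs a ha))
  · rw [Set.indicator_of_notMem ha]
    exact zero_le

theorem expect_productLaw_prod {ι : Type*} [Fintype ι] [DecidableEq ι] (μ : ι → PMF α)
    (g : ι → α → ℝ) :
    expect (productLaw μ) (fun x => ∏ i, g i (x i)) = ∏ i, expect (μ i) (g i) := by
  simp only [expect]
  rw [Finset.prod_univ_sum, Fintype.piFinset_univ]
  refine Finset.sum_congr rfl fun x _ => ?_
  rw [productLaw_toReal, Finset.prod_mul_distrib]

end Expect

/-! ### Exponential tail bounds for independent draws -/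

section Tails

variable {ι α : Type*} [Fintype ι] [Fintype α]

/-- Exponential Markov inequality and independence. Functions and exponents may vary with the index,
so that indices outside a chosen subset can contribute zero. -/
theorem chernoff_bound (μ : ι → PMF α) (h : ι → α → ℝ) (K : ι → ℝ) (c : ℝ)
    (hK : ∀ i, expect (μ i) (fun a => Real.exp (h i a)) ≤ Real.exp (K i)) :
    (productLaw μ).toOuterMeasure {x | c ≤ ∑ i, h i (x i)} ≤
      ENNReal.ofReal (Real.exp (∑ i, K i - c)) := by
  classical
  refine (markov_inequality _ (g := fun x => Real.exp (-c) * ∏ i, Real.exp (h i (x i)))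
    (fun x => by positivity) fun x hx => ?_).trans (ENNReal.ofReal_le_ofReal ?_)
  · rw [← Real.exp_sum, ← Real.exp_add]
    have : c ≤ ∑ i, h i (x i) := hx
    exact Real.one_le_exp (by linarith)
  · rw [expect_const_mul, expect_productLaw_prod μ fun i a => Real.exp (h i a), sub_eq_neg_add,
      Real.exp_add, Real.exp_sum]
    gcongr with i
    · intro i _
      exact expect_nonneg _ fun a => (Real.exp_pos _).le
    · exact hK i

/-- Symmetrization: the mean is replaced by an independent copy, exchanging the two copies turns
`exp` into `cosh`, and `cosh x ≤ exp (x² / 2)`. The constant is weaker than Hoeffding's but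
suffices. -/
theorem expect_exp_le_of_abs_sub_le (μ : PMF α) (g : α → ℝ) {D : ℝ}
    (hD : ∀ a a', |g a - g a'| ≤ D) (t : ℝ) :
    expect μ (fun a => Real.exp (t * (g a - expect μ g))) ≤ Real.exp (t ^ 2 * D ^ 2 / 2) := by
  have hcosh : ∀ a a', Real.cosh (t * (g a - g a')) ≤ Real.exp (t ^ 2 * D ^ 2 / 2) := by
    intro a a'
    refine (Real.cosh_le_exp_half_sq _).trans (Real.exp_le_exp.2 ?_)
    have := sq_le_sq' (neg_le_of_abs_le (hD a a')) (le_of_abs_le (hD a a'))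
    rw [mul_pow]
    gcongr
  calc expect μ (fun a => Real.exp (t * (g a - expect μ g)))
      ≤ expect μ (fun a => expect μ fun a' => Real.exp (t * (g a - g a'))) := by
        refine expect_mono fun a => ?_
        -- Jensen's inequality as a tangent-line bound at the mean; the linear term averages to zero
        -- over `a'`.
        have h1 : ∀ a', Real.exp (t * (g a - expect μ g)) * (1 + t * (expect μ g - g a')) ≤
            Real.exp (t * (g a - g a')) := by
          intro a'
          have h2 : Real.exp (t * (g a - g a')) =
              Real.exp (t * (g a - expect μ g)) * Real.exp (t * (expect μ g - g a')) := by
            rw [← Real.exp_add]; ring_nf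
          rw [h2]
          have := Real.add_one_le_exp (t * (expect μ g - g a'))
          gcongr
          linarith
        refine le_trans (le_of_eq ?_) (expect_mono h1)
        rw [expect_const_mul, expect_add, expect_const, expect_const_mul, expect_sub, expect_const]
        ring
    _ = expect μ (fun a => expect μ fun a' => Real.cosh (t * (g a - g a'))) := by
        have hsymm : expect μ (fun a => expect μ fun a' => Real.exp (t * (g a - g a'))) =
            expect μ (fun a => expect μ fun a' => Real.exp (-(t * (g a - g a')))) := by
          simp only [expect, Finset.mul_sum]
          rw [Finset.sum_comm]
          refine Finset.sum_congr rfl fun a _ => Finset.sum_congr rfl fun a' _ => ?_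
          rw [show -(t * (g a - g a')) = t * (g a' - g a) by ring]
          ring
        have : ∀ x : ℝ, Real.cosh x = (1 / 2) * Real.exp x + (1 / 2) * Real.exp (-x) := by
          intro x; rw [Real.cosh_eq]; ring
        simp only [this, expect_add, expect_const_mul]
        rw [← hsymm]; ring
    _ ≤ _ := expect_le_const _ fun a => expect_le_const _ fun a' => hcosh a a'

/-- The subset `T` serves to isolate one noise level inside the joint draw of all pairs, whose laws
differ between levels. -/
theorem hoeffding_upper (μ : ι → PMF α) (T : Finset ι) (g : α → ℝ) {D τ e : ℝ} (hD0 : 0 < D)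
    (hτ : 0 ≤ τ)
    (hD : ∀ a a', |g a - g a'| ≤ D) (he : ∀ i ∈ T, expect (μ i) g = e) :
    (productLaw μ).toOuterMeasure {x | T.card * τ ≤ ∑ i ∈ T, g (x i) - T.card * e} ≤
      ENNReal.ofReal (Real.exp (-(T.card * τ ^ 2 / (2 * D ^ 2)))) := by
  classical
  -- The minimizer of the exponent `t² D² / 2 - t τ`.
  set t := τ / D ^ 2 with ht
  have h := chernoff_bound μ (fun i a => if i ∈ T then t * (g a - e) else 0)
    (fun i => if i ∈ T then t ^ 2 * D ^ 2 / 2 else 0) (T.card * (t * τ)) (fun i => by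
      by_cases hi : i ∈ T
      · simp only [hi, if_true]
        have := expect_exp_le_of_abs_sub_le (μ i) g hD t
        rwa [he i hi] at this
      · simp [hi, expect_const])
  refine (MeasureTheory.measure_mono ?_).trans (h.trans_eq ?_)
  · intro x hx
    simp only [Set.mem_ofPred_eq] at hx ⊢
    rw [Finset.sum_ite_mem, Finset.univ_inter, ← Finset.mul_sum, Finset.sum_sub_distrib,
      Finset.sum_const, nsmul_eq_mul, mul_left_comm]
    gcongr
  · rw [Finset.sum_ite_mem, Finset.univ_inter, Finset.sum_const, nsmul_eq_mul, ht]
    congr 2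
    field_simp
    ring

theorem hoeffding_two_sided (μ : ι → PMF α) (T : Finset ι) (g : α → ℝ) {D τ e : ℝ} (hD0 : 0 < D)
    (hτ : 0 ≤ τ) (hD : ∀ a a', |g a - g a'| ≤ D) (he : ∀ i ∈ T, expect (μ i) g = e) :
    (productLaw μ).toOuterMeasure {x | T.card * τ ≤ |∑ i ∈ T, g (x i) - T.card * e|} ≤
      2 * ENNReal.ofReal (Real.exp (-(T.card * τ ^ 2 / (2 * D ^ 2)))) := by
  have h1 := hoeffding_upper μ T g hD0 hτ hD he
  have h2 := hoeffding_upper μ T (fun a => -1 * g a) (e := -1 * e) hD0 hτ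
    (fun a a' => by rw [← mul_sub, abs_mul]; simpa using hD a a')
    (fun i hi => by rw [expect_const_mul, he i hi])
  rw [two_mul]
  refine le_trans (MeasureTheory.measure_mono ?_)
    ((MeasureTheory.measure_union_le _ _).trans (add_le_add h1 h2))
  intro x hx
  simp only [Set.mem_ofPred_eq] at hx
  rcases le_abs.1 hx with h | h
  · exact Or.inl h
  · refine Or.inr ?_
    simp only [Set.mem_ofPred_eq, ← Finset.mul_sum]
    linarith

/-- Follows from `1 + u + u²/2 ≤ exp u`, because `(1 - u + u²/2) (1 + u + u²/2) = 1 + u⁴/4`. -/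
theorem exp_neg_le_quadratic {u : ℝ} (hu : 0 ≤ u) : Real.exp (-u) ≤ 1 - u + u ^ 2 / 2 := by
  have h1 := Real.quadratic_le_exp_of_nonneg hu
  have h2 : Real.exp (-u) * Real.exp u = 1 := by rw [← Real.exp_add]; simp
  have h3 := Real.exp_pos (-u)
  have h4 : Real.exp (-u) * (1 + u + u ^ 2 / 2) ≤ 1 :=
    (mul_le_mul_of_nonneg_left h1 h3.le).trans_eq h2
  have h5 : 1 ≤ (1 - u + u ^ 2 / 2) * (1 + u + u ^ 2 / 2) := by nlinarith [sq_nonneg (u ^ 2)]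
  have h6 : 0 < 1 + u + u ^ 2 / 2 := by positivity
  exact le_of_mul_le_mul_right (h4.trans h5) h6

/-- For `g ≥ 0` the function `exp (-l g)` is dominated by its quadratic Taylor polynomial, so
neither boundedness nor exponential moments are required. This is what handles arbitrary scores sent
by a prover. -/
theorem lower_tail_of_nonneg (μ : PMF α) (g : α → ℝ) (m : ℕ) {V t : ℝ} (hg : ∀ a, 0 ≤ g a)
    (hV : 0 < V) (hV' : expect μ (fun a => g a ^ 2) ≤ V) (ht : 0 ≤ t) :
    (productLaw fun _ : Fin m => μ).toOuterMeasure
        {x | ∑ i, g (x i) ≤ m * (expect μ g - t)} ≤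
      ENNReal.ofReal (Real.exp (-(m * (t ^ 2 / (2 * V))))) := by
  set l := t / V with hl
  have hl0 : 0 ≤ l := by positivity
  have h := chernoff_bound (fun _ : Fin m => μ) (fun _ a => -(l * g a))
    (fun _ => -(l * expect μ g) + l ^ 2 * V / 2) (-(m * (l * (expect μ g - t)))) fun _ => by
      refine le_trans (expect_mono fun a => exp_neg_le_quadratic (mul_nonneg hl0 (hg a))) ?_
      have : (fun a => 1 - l * g a + (l * g a) ^ 2 / 2) =
          fun a => (1 - l * g a) + (l ^ 2 / 2) * (g a ^ 2) := by funext a; ring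
      rw [this, expect_add, expect_sub, expect_const, expect_const_mul, expect_const_mul]
      refine le_trans ?_ (Real.add_one_le_exp _)
      have : l ^ 2 / 2 * expect μ (fun a => g a ^ 2) ≤ l ^ 2 / 2 * V := by gcongr
      linarith
  refine (MeasureTheory.measure_mono ?_).trans (h.trans_eq ?_)
  · intro x hx
    simp only [Set.mem_ofPred_eq, Finset.sum_neg_distrib, ← Finset.mul_sum] at hx ⊢
    rw [mul_left_comm]
    gcongr
  · simp only [Finset.sum_const, Finset.card_univ, Fintype.card_fin, nsmul_eq_mul]
    congr 2
    rw [hl]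
    field_simp
    ring

/-- The bound `exp u - 1 ≤ u exp u`, applied twice. -/
theorem exp_le_one_add_add_sq_mul_exp {u : ℝ} (hu : 0 ≤ u) :
    Real.exp u ≤ 1 + u + u ^ 2 * Real.exp u := by
  have h1 : Real.exp u - 1 ≤ u * Real.exp u := by
    have h2 : Real.exp (-u) * Real.exp u = 1 := by rw [← Real.exp_add]; simp
    nlinarith [Real.one_sub_le_exp_neg u, Real.exp_pos u]
  nlinarith

/-- An exponential moment at rate `2 l` controls the second-order term `g² exp (t g)` at every rate
`t ≤ l`: one factor `exp (l g)` absorbs `g²`, the other absorbs `exp (t g)`. -/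
theorem upper_tail_of_exp_moment (μ : PMF α) (g : α → ℝ) (m : ℕ) {l A s : ℝ} (hg : ∀ a, 0 ≤ g a)
    (hl : 0 < l) (hl1 : l ≤ 1) (hA : 1 ≤ A)
    (hA' : expect μ (fun a => Real.exp (2 * l * g a)) ≤ A) (hs : 0 ≤ s) (hs1 : s ≤ 1) :
    (productLaw fun _ : Fin m => μ).toOuterMeasure
        {x | m * (expect μ g + s) ≤ ∑ i, g (x i)} ≤
      ENNReal.ofReal (Real.exp (-(m * (s ^ 2 * l ^ 2 / (8 * A))))) := by
  -- Chosen so that `t = l η s` minimizes `2 A t² / l² - t s`; the bounds on `l`, `A`, `s` ensure `t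
  -- ≤ l`.
  set η := l / (4 * A) with hη
  have hη1 : η ≤ 1 := by rw [hη, div_le_one (by positivity)]; linarith
  have hη0 : 0 ≤ η := by positivity
  set t := l * (η * s) with ht
  have htl : t ≤ l := mul_le_of_le_one_right hl.le (mul_le_one₀ hη1 hs hs1)
  have ht0 : 0 ≤ t := by positivity
  have hsq : ∀ a, g a ^ 2 * Real.exp (t * g a) ≤ 2 / l ^ 2 * Real.exp (2 * l * g a) := by
    intro a
    have h1 := Real.quadratic_le_exp_of_nonneg (mul_nonneg hl.le (hg a))
    have h2 : g a ^ 2 ≤ 2 / l ^ 2 * Real.exp (l * g a) := by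
      rw [div_mul_eq_mul_div, le_div_iff₀ (by positivity)]
      nlinarith [mul_nonneg hl.le (hg a)]
    have h3 : Real.exp (t * g a) ≤ Real.exp (l * g a) :=
      Real.exp_le_exp.2 (mul_le_mul_of_nonneg_right htl (hg a))
    have h4 : Real.exp (2 * l * g a) = Real.exp (l * g a) * Real.exp (l * g a) := by
      rw [← Real.exp_add]; ring_nf
    rw [h4, ← mul_assoc]
    gcongr
  have h := chernoff_bound (fun _ : Fin m => μ) (fun _ a => t * g a)
    (fun _ => t * expect μ g + t ^ 2 * (2 / l ^ 2 * A)) (m * (t * (expect μ g + s))) fun _ => by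
      have h1 : ∀ a, Real.exp (t * g a) ≤
          (1 + t * g a) + t ^ 2 * (2 / l ^ 2 * Real.exp (2 * l * g a)) := by
        intro a
        refine (exp_le_one_add_add_sq_mul_exp (mul_nonneg ht0 (hg a))).trans ?_
        rw [mul_pow, mul_assoc (t ^ 2)]
        exact add_le_add le_rfl (mul_le_mul_of_nonneg_left (hsq a) (sq_nonneg t))
      refine (expect_mono h1).trans ?_
      rw [expect_add, expect_add, expect_const, expect_const_mul, expect_const_mul,
        expect_const_mul]
      refine le_trans ?_ (Real.add_one_le_exp _)
      have : t ^ 2 * (2 / l ^ 2 * expect μ fun a => Real.exp (2 * l * g a)) ≤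
        t ^ 2 * (2 / l ^ 2 * A) := by gcongr
      linarith
  refine (MeasureTheory.measure_mono ?_).trans (h.trans_eq ?_)
  · intro x hx
    simp only [Set.mem_ofPred_eq, ← Finset.mul_sum] at hx ⊢
    rw [mul_left_comm]
    gcongr
  · simp only [Finset.sum_const, Finset.card_univ, Fintype.card_fin, nsmul_eq_mul]
    congr 2
    rw [ht, hη]
    field_simp
    ring

end Tails

/-! ### Probabilities of sequential draws -/

section Bind

variable {α β γ : Type*}

theorem toOuterMeasure_le_one (q : PMF α) (s : Set α) : q.toOuterMeasure s ≤ 1 := by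
  rw [PMF.toOuterMeasure_apply, ← q.tsum_coe]
  exact ENNReal.tsum_le_tsum fun a => Set.indicator_le_self s q a

/-- A union bound along sequential draws: `η` pays for a bad first draw, `ε` for failure after a
good one. Iterating it follows the protocol draw by draw. -/
theorem toOuterMeasure_bind_le_add (q : PMF α) (k : α → PMF β) (s : Set β) (A : Set α) {ε η : ℝ≥0∞}
    (hA : q.toOuterMeasure A ≤ η) (h : ∀ a ∉ A, (k a).toOuterMeasure s ≤ ε) :
    (q.bind k).toOuterMeasure s ≤ η + ε := by
  classical
  rw [PMF.toOuterMeasure_bind_apply]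
  have h1 : ∀ a, q a * (k a).toOuterMeasure s ≤ A.indicator q a + q a * ε := by
    intro a
    by_cases ha : a ∈ A
    · rw [Set.indicator_of_mem ha]
      exact le_add_right (mul_le_of_le_one_right' (toOuterMeasure_le_one _ _))
    · exact le_add_left (mul_le_mul_right (h a ha) _)
  refine (ENNReal.tsum_le_tsum h1).trans ?_
  rw [ENNReal.tsum_add, ENNReal.tsum_mul_right, q.tsum_coe, one_mul, ← PMF.toOuterMeasure_apply]
  gcongr

theorem toOuterMeasure_bind_le (q : PMF α) (k : α → PMF β) (s : Set β) {ε : ℝ≥0∞}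
    (h : ∀ a, (k a).toOuterMeasure s ≤ ε) : (q.bind k).toOuterMeasure s ≤ ε := by
  simpa using toOuterMeasure_bind_le_add q k s ∅ (η := 0) (by simp) fun a _ => h a

theorem ofReal_one_sub_le_toOuterMeasure (q : PMF α) (s : Set α) {δ : ℝ} (hδ : 0 ≤ δ)
    (h : q.toOuterMeasure sᶜ ≤ ENNReal.ofReal δ) :
    ENNReal.ofReal (1 - δ) ≤ q.toOuterMeasure s := by
  rw [ENNReal.ofReal_sub _ hδ, ENNReal.ofReal_one, tsub_le_iff_right]
  calc 1 = q.toOuterMeasure (s ∪ sᶜ) := by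
        rw [Set.union_compl_self, PMF.toOuterMeasure_apply, Set.indicator_univ, q.tsum_coe]
    _ ≤ _ := (MeasureTheory.measure_union_le _ _).trans (add_le_add le_rfl h)

end Bind

/-! ### Fourier analysis on the biased cube -/

/-- The centred coordinate function under the law `signLaw p`. -/
def centred (p : ℝ) (u : ℤˣ) : ℝ := ((u : ℤ) : ℝ) - (2 * p - 1)

/-- The variance of a coordinate under the law `signLaw p`. -/
def signVar (p : ℝ) : ℝ := 4 * p * (1 - p)

/-- The (unnormalized) Fourier coefficient of `f` at the set `S` of coordinates. -/
def fourierCoeff (p : ℝ) {N : ℕ} (f : Cube N → ℝ) (S : Finset (Fin N)) : ℝ :=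
  expect (biasedLaw p N) fun x => f x * ∏ i ∈ S, centred p (x i)

/-- The share of the set `S` in the second moment of `f`. -/
def fourierWeight (p : ℝ) {N : ℕ} (f : Cube N → ℝ) (S : Finset (Fin N)) : ℝ :=
  fourierCoeff p f S ^ 2 / signVar p ^ S.card

theorem signLaw_one_toReal {q : ℝ} (h0 : 0 ≤ q) (h1 : q ≤ 1) : (signLaw q 1).toReal = q := by
  have : signLaw q 1 = min 1 (ENNReal.ofReal q) := by simp [signLaw]
  rw [this, min_eq_right (ENNReal.ofReal_le_one.2 h1), ENNReal.toReal_ofReal h0]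

theorem signLaw_neg_one_toReal {q : ℝ} (h0 : 0 ≤ q) (h1 : q ≤ 1) :
    (signLaw q (-1)).toReal = 1 - q := by
  have : signLaw q (-1) = 1 - min 1 (ENNReal.ofReal q) := by
    have h : ¬ ((-1 : ℤˣ) = 1) := by decide
    simp [signLaw, h]
  rw [this, min_eq_right (ENNReal.ofReal_le_one.2 h1),
    ENNReal.toReal_sub_of_le (ENNReal.ofReal_le_one.2 h1) ENNReal.one_ne_top,
    ENNReal.toReal_ofReal h0, ENNReal.toReal_one]

theorem centred_one (p : ℝ) : centred p 1 = 2 * (1 - p) := by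
  simp [centred]; ring

theorem centred_neg_one (p : ℝ) : centred p (-1) = -(2 * p) := by
  simp [centred]; ring

theorem sum_units_int (g : ℤˣ → ℝ) : ∑ u, g u = g 1 + g (-1) := by
  have h : (Finset.univ : Finset ℤˣ) = {1, -1} := rfl
  rw [h, Finset.sum_pair (by decide)]

section

variable {p : ℝ}

theorem signVar_pos (hp0 : 0 < p) (hp1 : p < 1) : 0 < signVar p := by
  have : 0 < 1 - p := by linarith
  unfold signVar; positivity

theorem expect_signLaw (hp0 : 0 < p) (hp1 : p < 1) (g : ℤˣ → ℝ) : expect (signLaw p) g = p * g 1 + (1 - p) * g (-1) := by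
  rw [expect, sum_units_int, signLaw_one_toReal hp0.le hp1.le, signLaw_neg_one_toReal hp0.le hp1.le]

theorem expect_centred (hp0 : 0 < p) (hp1 : p < 1) : expect (signLaw p) (centred p) = 0 := by
  rw [expect_signLaw hp0 hp1, centred_one, centred_neg_one]; ring

theorem expect_centred_sq (hp0 : 0 < p) (hp1 : p < 1) :
    expect (signLaw p) (fun u => centred p u * centred p u) = signVar p := by
  rw [expect_signLaw hp0 hp1, centred_one, centred_neg_one, signVar]; ring

/-- The kernel of the noise operator on one coordinate. -/
theorem signLaw_mul_correlated_toReal (hp0 : 0 < p) (hp1 : p < 1) {ρ : ℝ} (hρ0 : 0 ≤ ρ) (hρ1 : ρ ≤ 1) (u w : ℤˣ) :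
    (signLaw p u).toReal *
        ((if u = 1 then signLaw (1 - (1 - p) * (1 - ρ)) else signLaw (p * (1 - ρ))) w).toReal =
      (signLaw p u).toReal * (signLaw p w).toReal *
        (1 + ρ / signVar p * (centred p u * centred p w)) := by
  have h1 : 0 < 1 - p := by linarith
  have h2 : 0 ≤ 1 - ρ := by linarith
  have a1 : (1 - p) * (1 - ρ) ≤ 1 := mul_le_one₀ (by linarith) h2 (by linarith)
  have a2 : p * (1 - ρ) ≤ 1 := mul_le_one₀ hp1.le h2 (by linarith)
  have b1 : 0 ≤ (1 - p) * (1 - ρ) := by positivity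
  have b2 : 0 ≤ p * (1 - ρ) := by positivity
  have hne : ¬ ((-1 : ℤˣ) = 1) := by decide
  rcases Int.units_eq_one_or u with rfl | rfl <;> rcases Int.units_eq_one_or w with rfl | rfl <;>
    simp only [if_true, if_neg hne, centred_one, centred_neg_one,
      signLaw_one_toReal hp0.le hp1.le, signLaw_neg_one_toReal hp0.le hp1.le,
      signLaw_one_toReal (sub_nonneg.2 a1) (sub_le_self _ b1),
      signLaw_neg_one_toReal (sub_nonneg.2 a1) (sub_le_self _ b1),
      signLaw_one_toReal b2 a2, signLaw_neg_one_toReal b2 a2, signVar] <;> field_simp <;> ring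

variable {N : ℕ}

theorem correlatedPairLaw_apply (p ρ : ℝ) (x x' : Cube N) :
    correlatedPairLaw p ρ N (x, x') = biasedLaw p N x * correlatedLaw p ρ x x' := by
  classical
  rw [correlatedPairLaw, PMF.bind_apply, tsum_eq_single x]
  · congr 1
    rw [PMF.map_apply, tsum_eq_single x']
    · simp
    · intro y hy
      simp [Ne.symm hy]
  · intro y hy
    rw [PMF.map_apply]
    simp [Ne.symm hy]

/-- Relative to an independent pair, the correlated pair has density `∏ (1 + (ρ / v) c(xᵢ) c(x'ᵢ))`,
where `c` is the centred coordinate and `v` its variance. Expanding the product gives one term per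
set `S`, and each splits into a function of `x` times the same function of `x'`. Completeness of the
characters is not needed. -/
theorem expect_correlatedPairLaw (hp0 : 0 < p) (hp1 : p < 1) {ρ : ℝ} (hρ0 : 0 ≤ ρ) (hρ1 : ρ ≤ 1) (f : Cube N → ℝ) :
    expect (correlatedPairLaw p ρ N) (fun q => f q.1 * f q.2) =
      ∑ S : Finset (Fin N), ρ ^ S.card * fourierWeight p f S := by
  have key : ∀ x x' : Cube N, (correlatedPairLaw p ρ N (x, x')).toReal =
      ∑ S : Finset (Fin N), (ρ / signVar p) ^ S.card *
        (((biasedLaw p N x).toReal * ∏ i ∈ S, centred p (x i)) *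
          ((biasedLaw p N x').toReal * ∏ i ∈ S, centred p (x' i))) := by
    intro x x'
    have h : (correlatedPairLaw p ρ N (x, x')).toReal =
        ((biasedLaw p N x).toReal * (biasedLaw p N x').toReal) *
          ∏ i, (1 + ρ / signVar p * (centred p (x i) * centred p (x' i))) := by
      rw [correlatedPairLaw_apply, ENNReal.toReal_mul]
      simp only [biasedLaw, correlatedLaw, productLaw_toReal]
      rw [← Finset.prod_mul_distrib, ← Finset.prod_mul_distrib, ← Finset.prod_mul_distrib]
      exact Finset.prod_congr rfl fun i _ => signLaw_mul_correlated_toReal hp0 hp1 hρ0 hρ1 _ _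
    rw [h, Finset.prod_one_add, Finset.powerset_univ, Finset.mul_sum]
    refine Finset.sum_congr rfl fun S _ => ?_
    rw [Finset.prod_mul_distrib, Finset.prod_mul_distrib, Finset.prod_const]
    ring
  rw [expect, Fintype.sum_prod_type]
  simp only [key, Finset.sum_mul]
  rw [Finset.sum_congr rfl fun x _ => Finset.sum_comm, Finset.sum_comm]
  refine Finset.sum_congr rfl fun S _ => ?_
  rw [fourierWeight, fourierCoeff, sq, expect, Finset.sum_mul_sum, Finset.sum_div, Finset.mul_sum]
  refine Finset.sum_congr rfl fun x _ => ?_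
  rw [Finset.sum_div, Finset.mul_sum]
  refine Finset.sum_congr rfl fun x' _ => ?_
  rw [div_pow]
  ring

theorem fourierWeight_nonneg (hp0 : 0 < p) (hp1 : p < 1) (f : Cube N → ℝ) (S : Finset (Fin N)) : 0 ≤ fourierWeight p f S := by
  have := signVar_pos hp0 hp1
  unfold fourierWeight; positivity

/-- The case `ρ = 1` of the stability formula, where no coordinate is flipped and the pair is almost
surely diagonal. -/
theorem parseval (hp0 : 0 < p) (hp1 : p < 1) (f : Cube N → ℝ) :
    expect (biasedLaw p N) (fun x => f x ^ 2) = ∑ S : Finset (Fin N), fourierWeight p f S := by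
  have h := expect_correlatedPairLaw hp0 hp1 zero_le_one le_rfl f
  simp only [one_pow, one_mul] at h
  rw [← h, expect, expect, Fintype.sum_prod_type]
  refine Finset.sum_congr rfl fun x _ => ?_
  rw [Finset.sum_eq_single x]
  · rw [correlatedPairLaw_apply, ENNReal.toReal_mul]
    have : (correlatedLaw p 1 x x).toReal = 1 := by
      rw [correlatedLaw, productLaw_toReal]
      refine Finset.prod_eq_one fun i _ => ?_
      have hne : ¬ ((-1 : ℤˣ) = 1) := by decide
      rcases Int.units_eq_one_or (x i) with hi | hi <;> rw [hi]
      · simp [signLaw_one_toReal]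
      · simp [hne, signLaw_neg_one_toReal]
    rw [this]; ring
  · intro y _ hy
    obtain ⟨i, hi⟩ := Function.ne_iff.1 hy
    rw [correlatedPairLaw_apply, ENNReal.toReal_mul]
    have : (correlatedLaw p 1 x y).toReal = 0 := by
      rw [correlatedLaw, productLaw_toReal]
      refine Finset.prod_eq_zero (Finset.mem_univ i) ?_
      have hne : ¬ ((-1 : ℤˣ) = 1) := by decide
      rcases Int.units_eq_one_or (x i) with hx | hx <;>
        rcases Int.units_eq_one_or (y i) with hy' | hy' <;> simp_all [signLaw_one_toReal, signLaw_neg_one_toReal]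
    rw [this]; ring
  · simp

/-! ### Linear datamodels -/

theorem expect_biasedLaw_centred (hp0 : 0 < p) (hp1 : p < 1) (i : Fin N) :
    expect (biasedLaw p N) (fun x => centred p (x i)) = 0 := by
  have h := expect_productLaw_prod (fun _ : Fin N => signLaw p)
    (fun k u => if k = i then centred p u else 1)
  rw [Finset.prod_eq_zero (Finset.mem_univ i) (by simpa using expect_centred hp0 hp1)] at h
  simpa [biasedLaw] using h

theorem expect_biasedLaw_centred_mul (hp0 : 0 < p) (hp1 : p < 1) (i j : Fin N) :
    expect (biasedLaw p N) (fun x => centred p (x i) * centred p (x j)) =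
      if i = j then signVar p else 0 := by
  have h := expect_productLaw_prod (fun _ : Fin N => signLaw p)
    (fun k u => (if k = i then centred p u else 1) * (if k = j then centred p u else 1))
  simp only [Finset.prod_mul_distrib, Finset.prod_ite_eq', Finset.mem_univ, if_true] at h
  rw [biasedLaw, h]
  split_ifs with hij
  · subst hij
    rw [Finset.prod_eq_single i]
    · simpa using expect_centred_sq hp0 hp1
    · intro k _ hk
      simp [hk, expect_const]
    · simp
  · refine Finset.prod_eq_zero (Finset.mem_univ i) ?_
    simpa [hij] using expect_centred hp0 hp1

/-- The mean of a linear datamodel. -/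
def Scores.mean (p : ℝ) (a : Scores N) : ℝ := a.intercept + (2 * p - 1) * ∑ i, a.weights i

/-- The centred part of a linear datamodel. -/
def Scores.centredPart (p : ℝ) (a : Scores N) (x : Cube N) : ℝ :=
  ∑ i, a.weights i * centred p (x i)

theorem Scores.predict_eq (a : Scores N) (x : Cube N) :
    a.predict x = a.mean p + a.centredPart p x := by
  simp only [Scores.predict, Scores.mean, Scores.centredPart, centred, mul_sub,
    Finset.sum_sub_distrib, ← Finset.sum_mul]
  ring

theorem expect_centredPart (hp0 : 0 < p) (hp1 : p < 1) (a : Scores N) : expect (biasedLaw p N) (a.centredPart p) = 0 := by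
  rw [show (a.centredPart p) = fun x => ∑ i, a.weights i * centred p (x i) from rfl, expect_sum]
  simp [expect_const_mul, expect_biasedLaw_centred hp0 hp1]

theorem expect_centredPart_sq (hp0 : 0 < p) (hp1 : p < 1) (a : Scores N) :
    expect (biasedLaw p N) (fun x => a.centredPart p x ^ 2) =
      signVar p * ∑ i, a.weights i ^ 2 := by
  have : (fun x => a.centredPart p x ^ 2) = fun x => ∑ i, ∑ j, (a.weights i * a.weights j) *
      (centred p (x i) * centred p (x j)) := by
    funext x
    rw [Scores.centredPart, sq, Finset.sum_mul_sum]
    exact Finset.sum_congr rfl fun i _ => Finset.sum_congr rfl fun j _ => by ring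
  rw [this]
  simp only [expect_sum, expect_const_mul, expect_biasedLaw_centred_mul hp0 hp1, mul_ite, mul_zero,
    Finset.sum_ite_eq, Finset.mem_univ, if_true, Finset.mul_sum]
  exact Finset.sum_congr rfl fun i _ => by ring

theorem expect_mul_centredPart (f : Cube N → ℝ) (a : Scores N) :
    expect (biasedLaw p N) (fun x => f x * a.centredPart p x) =
      ∑ i, a.weights i * fourierCoeff p f {i} := by
  have : (fun x => f x * a.centredPart p x) =
      fun x => ∑ i, a.weights i * (f x * ∏ k ∈ {i}, centred p (x k)) := by
    funext x
    rw [Scores.centredPart, Finset.mul_sum]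
    exact Finset.sum_congr rfl fun i _ => by rw [Finset.prod_singleton]; ring
  rw [this]
  simp only [expect_sum, expect_const_mul, fourierCoeff]

/-- The part of the second moment of `f` that is carried by sets of at least two coordinates. -/
def residual (p : ℝ) (f : Cube N → ℝ) : ℝ :=
  expect (biasedLaw p N) (fun x => f x ^ 2) - fourierWeight p f ∅ - ∑ i, fourierWeight p f {i}

/-- Pythagoras: in the orthogonal system of the constant and the centred coordinates, each
coefficient of the datamodel can be completed to a square separately. -/
theorem mse_eq (hp0 : 0 < p) (hp1 : p < 1) (f : Cube N → ℝ) (a : Scores N) :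
    mse p f a = residual p f + ((a.mean p - fourierCoeff p f ∅) ^ 2 +
      signVar p * ∑ i, (a.weights i - fourierCoeff p f {i} / signVar p) ^ 2) := by
  have hv := (signVar_pos hp0 hp1).ne'
  have h0 : mse p f a = expect (biasedLaw p N) (fun x => ((f x ^ 2 + a.mean p ^ 2) +
      a.centredPart p x ^ 2) - (2 * a.mean p * f x + 2 * (f x * a.centredPart p x)) +
        2 * a.mean p * a.centredPart p x) := by
    refine Finset.sum_congr rfl fun x _ => ?_
    rw [Scores.predict_eq (p := p)]; ring
  have h1 : fourierCoeff p f ∅ = expect (biasedLaw p N) f := by simp [fourierCoeff]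
  rw [h0]
  simp only [expect_add, expect_sub, expect_const, expect_const_mul]
  rw [expect_centredPart_sq hp0 hp1, expect_mul_centredPart, expect_centredPart hp0 hp1,
    residual, ← h1]
  have h2 : signVar p * ∑ i, (a.weights i - fourierCoeff p f {i} / signVar p) ^ 2 =
      signVar p * ∑ i, a.weights i ^ 2 - 2 * ∑ i, a.weights i * fourierCoeff p f {i} +
        ∑ i, fourierWeight p f {i} := by
    simp only [Finset.mul_sum, ← Finset.sum_sub_distrib, ← Finset.sum_add_distrib, fourierWeight,
      Finset.card_singleton, pow_one]
    refine Finset.sum_congr rfl fun i _ => ?_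
    field_simp
    ring
  rw [h2, fourierWeight, Finset.card_empty, pow_zero, div_one]
  ring

theorem exists_mse_eq_residual (hp0 : 0 < p) (hp1 : p < 1) (f : Cube N → ℝ) : ∃ a : Scores N, mse p f a = residual p f := by
  let w : Fin N → ℝ := fun i => fourierCoeff p f {i} / signVar p
  refine ⟨⟨fourierCoeff p f ∅ - (2 * p - 1) * ∑ i, w i, w⟩, ?_⟩
  rw [mse_eq hp0 hp1]
  simp [Scores.mean, w]

theorem residual_le_mse (hp0 : 0 < p) (hp1 : p < 1) (f : Cube N → ℝ) (a : Scores N) : residual p f ≤ mse p f a := by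
  rw [mse_eq hp0 hp1]
  have := signVar_pos hp0 hp1
  exact le_add_of_nonneg_right (by positivity)

theorem isOptimal_optimalScores (hp0 : 0 < p) (hp1 : p < 1) (f : Cube N → ℝ) : IsOptimal p f (optimalScores p f) := by
  obtain ⟨a, ha⟩ := exists_mse_eq_residual hp0 hp1 f
  exact Classical.epsilon_spec (p := IsOptimal p f)
    ⟨a, fun a' => ha.trans_le (residual_le_mse hp0 hp1 f a')⟩

theorem mse_optimalScores (hp0 : 0 < p) (hp1 : p < 1) (f : Cube N → ℝ) : mse p f (optimalScores p f) = residual p f := by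
  obtain ⟨a, ha⟩ := exists_mse_eq_residual hp0 hp1 f
  exact le_antisymm ((isOptimal_optimalScores hp0 hp1 f a).trans_eq ha)
    (residual_le_mse hp0 hp1 f _)

theorem mse_eq_residual_add_err (hp0 : 0 < p) (hp1 : p < 1) (f : Cube N → ℝ) (a : Scores N) :
    mse p f a = residual p f + err p f a := by
  rw [err, mse_optimalScores hp0 hp1]; ring

theorem err_optimalScores (f : Cube N → ℝ) : err p f (optimalScores p f) = 0 := sub_self _

/-- Bessel's inequality, since the residual is attained as a mean squared error and is therefore
nonnegative. -/
theorem fourierWeight_low_sum_le (hp0 : 0 < p) (hp1 : p < 1) (f : Cube N → ℝ) :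
    fourierWeight p f ∅ + ∑ i, fourierWeight p f {i} ≤
      expect (biasedLaw p N) (fun x => f x ^ 2) := by
  obtain ⟨a, ha⟩ := exists_mse_eq_residual hp0 hp1 f
  have h : 0 ≤ mse p f a := expect_nonneg (biasedLaw p N) fun x => sq_nonneg (f x - a.predict x)
  rw [ha, residual] at h
  linarith

/-- The second moment of a datamodel is bounded in terms of its error. -/
theorem mean_sq_add_weights_sq_le (hp0 : 0 < p) (hp1 : p < 1) (f : Cube N → ℝ) (a : Scores N) :
    a.mean p ^ 2 + signVar p * ∑ i, a.weights i ^ 2 ≤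
      2 * err p f a + 2 * expect (biasedLaw p N) (fun x => f x ^ 2) := by
  have hv := signVar_pos hp0 hp1
  have h1 := mse_eq hp0 hp1 f a
  rw [mse_eq_residual_add_err hp0 hp1, add_right_inj] at h1
  have h2 := fourierWeight_low_sum_le hp0 hp1 f
  have h3 : signVar p * ∑ i, a.weights i ^ 2 ≤
      2 * (signVar p * ∑ i, (a.weights i - fourierCoeff p f {i} / signVar p) ^ 2) +
        2 * ∑ i, fourierWeight p f {i} := by
    simp only [Finset.mul_sum, ← Finset.sum_add_distrib, fourierWeight, Finset.card_singleton,
      pow_one]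
    refine Finset.sum_le_sum fun i _ => ?_
    set z := fourierCoeff p f {i} / signVar p with hz
    have : fourierCoeff p f {i} ^ 2 / signVar p = signVar p * z ^ 2 := by
      rw [hz]; field_simp
    rw [this]
    -- The inequality `w² ≤ 2 (w - z)² + 2 z²` is `(w - 2 z)² ≥ 0`.
    nlinarith [mul_nonneg hv.le (sq_nonneg (a.weights i - 2 * z))]
  have h4 : fourierWeight p f ∅ = fourierCoeff p f ∅ ^ 2 := by simp [fourierWeight]
  rw [h4] at h2
  nlinarith [sq_nonneg (a.mean p - 2 * fourierCoeff p f ∅)]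

end

/-! ### Moments of linear datamodels -/

section

variable {p : ℝ} {N : ℕ}

/-- Sub-Gaussianity by independence: the `i`-th summand has range `2 |wᵢ|`, which contributes `t² (2
wᵢ)² / 2` to the exponent. -/
theorem expect_exp_centredPart_le (hp0 : 0 < p) (hp1 : p < 1) (a : Scores N) (t : ℝ) :
    expect (biasedLaw p N) (fun x => Real.exp (t * a.centredPart p x)) ≤
      Real.exp (2 * t ^ 2 * ∑ i, a.weights i ^ 2) := by
  have h : ∀ x, Real.exp (t * a.centredPart p x) =
      ∏ i, Real.exp (t * (a.weights i * centred p (x i))) := by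
    intro x
    rw [← Real.exp_sum, Scores.centredPart, Finset.mul_sum]
  simp only [h]
  rw [biasedLaw, expect_productLaw_prod (fun _ : Fin N => signLaw p)
    fun i u => Real.exp (t * (a.weights i * centred p u)), Finset.mul_sum, Real.exp_sum]
  refine Finset.prod_le_prod (fun i _ => expect_nonneg _ fun u => (Real.exp_pos _).le)
    fun i _ => ?_
  have h1 := expect_exp_le_of_abs_sub_le (signLaw p) (fun u => a.weights i * centred p u)
    (D := 2 * |a.weights i|) (fun u u' => by
      rw [← mul_sub, abs_mul, mul_comm 2]
      refine mul_le_mul_of_nonneg_left ?_ (abs_nonneg _)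
      rcases Int.units_eq_one_or u with rfl | rfl <;>
        rcases Int.units_eq_one_or u' with rfl | rfl <;> norm_num [centred]) t
  rw [expect_const_mul, expect_centred hp0 hp1, mul_zero] at h1
  simp only [sub_zero] at h1
  refine h1.trans (le_of_eq ?_)
  rw [mul_pow, sq_abs]
  ring_nf

/-- At rate `t² = 1 / (2 s)` both exponential moments are at most `e ≤ 3`, and `(t y)⁴ / 24 ≤ exp |t
y|`; the constant is `24 · 4 · (3 + 3)`. A separate bound `s > 0` also covers zero weights. -/
theorem expect_centredPart_pow_four_le (hp0 : 0 < p) (hp1 : p < 1) (a : Scores N) {s : ℝ}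
    (hs : 0 < s) (has : ∑ i, a.weights i ^ 2 ≤ s) :
    expect (biasedLaw p N) (fun x => a.centredPart p x ^ 4) ≤ 576 * s ^ 2 := by
  set t := (√(2 * s))⁻¹ with ht
  have ht2 : t ^ 2 = 1 / (2 * s) := by
    rw [ht, inv_pow, Real.sq_sqrt (by positivity), one_div]
  have hexp : ∀ t' : ℝ, t' ^ 2 = 1 / (2 * s) →
      expect (biasedLaw p N) (fun x => Real.exp (t' * a.centredPart p x)) ≤ 3 := by
    intro t' ht'
    refine (expect_exp_centredPart_le hp0 hp1 a t').trans ?_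
    refine (Real.exp_le_exp.2 ?_).trans (Real.exp_one_lt_d9.le.trans (by norm_num))
    rw [ht', mul_one_div, div_mul_eq_mul_div, div_le_one (by positivity)]
    linarith
  have hpt : ∀ x, a.centredPart p x ^ 4 ≤ 96 * s ^ 2 *
      (Real.exp (t * a.centredPart p x) + Real.exp (-t * a.centredPart p x)) := by
    intro x
    set y := a.centredPart p x
    have h1 := Real.pow_div_factorial_le_exp _ (abs_nonneg (t * y)) 4
    have h2 : |t * y| ^ 4 = y ^ 4 / (4 * s ^ 2) := by
      rw [pow_abs, abs_of_nonneg (by positivity), mul_pow, show t ^ 4 = (t ^ 2) ^ 2 by ring, ht2]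
      field_simp; ring
    have h3 : Real.exp |t * y| ≤ Real.exp (t * y) + Real.exp (-t * y) := by
      rw [neg_mul]
      rcases abs_cases (t * y) with ⟨h, _⟩ | ⟨h, _⟩ <;> rw [h] <;>
        linarith [Real.exp_pos (t * y), Real.exp_pos (-(t * y))]
    have h4 := h1.trans h3
    rw [h2, div_div, div_le_iff₀ (by positivity)] at h4
    norm_num [Nat.factorial] at h4
    calc y ^ 4 ≤ _ := h4
      _ = _ := by ring_nf
  refine (expect_mono hpt).trans ?_
  rw [expect_const_mul, expect_add]
  have h1 := hexp t ht2
  have h2 := hexp (-t) (by rw [neg_sq, ht2])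
  calc _ ≤ 96 * s ^ 2 * (3 + 3) := by gcongr
    _ = _ := by ring

theorem integrable_exp_mul_sub_half_sq (a : ℝ) :
    MeasureTheory.Integrable fun x : ℝ => Real.exp (a * x - x ^ 2 / 2) := by
  have h := ((integrable_exp_neg_mul_sq (b := 1 / 2) (by norm_num)).comp_sub_right a).const_mul
    (Real.exp (a ^ 2 / 2))
  refine h.congr (Filter.Eventually.of_forall fun x => ?_)
  simp only []
  rw [← Real.exp_add]
  ring_nf

theorem integral_exp_mul_sub_half_sq (a : ℝ) :
    ∫ x : ℝ, Real.exp (a * x - x ^ 2 / 2) = Real.exp (a ^ 2 / 2) * √(2 * Real.pi) := by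
  have h := integral_gaussian (1 / 2)
  rw [← MeasureTheory.integral_sub_right_eq_self _ a] at h
  have h2 : (fun x : ℝ => Real.exp (a * x - x ^ 2 / 2)) =
      fun x => Real.exp (a ^ 2 / 2) * Real.exp (-(1 / 2) * (x - a) ^ 2) := by
    funext x
    rw [← Real.exp_add]
    ring_nf
  rw [h2, MeasureTheory.integral_const_mul, h]
  congr 2
  ring

/-- The square is linearized by a Gaussian integral: `exp (y² / (16 s))` is an average of `exp (c y
z)` over a standard Gaussian `z`, with `c² = 1 / (8 s)`. The sub-Gaussian bound costs `z² / 4`,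
leaving `exp (-z² / 4)`; the resulting ratio is `√2 ≤ 2`. -/
theorem expect_exp_centredPart_sq_le (hp0 : 0 < p) (hp1 : p < 1) (a : Scores N) {s : ℝ}
    (hs : 0 < s) (has : ∑ i, a.weights i ^ 2 ≤ s) :
    expect (biasedLaw p N) (fun x => Real.exp (a.centredPart p x ^ 2 / (16 * s))) ≤ 2 := by
  set c := (√(8 * s))⁻¹ with hc
  have hc2 : c ^ 2 = 1 / (8 * s) := by
    rw [hc, inv_pow, Real.sq_sqrt (by positivity), one_div]
  have hpi : 0 < √(2 * Real.pi) := by positivity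
  have h1 : ∀ x, Real.exp (a.centredPart p x ^ 2 / (16 * s)) * √(2 * Real.pi) =
      ∫ z : ℝ, Real.exp ((c * a.centredPart p x) * z - z ^ 2 / 2) := by
    intro x
    rw [integral_exp_mul_sub_half_sq, mul_pow, hc2]
    congr 2
    field_simp
    ring
  have h2 : expect (biasedLaw p N) (fun x => Real.exp (a.centredPart p x ^ 2 / (16 * s))) *
      √(2 * Real.pi) = ∫ z : ℝ, expect (biasedLaw p N) fun x =>
        Real.exp ((c * a.centredPart p x) * z - z ^ 2 / 2) := by
    simp only [expect]
    rw [MeasureTheory.integral_finsetSum _ fun x _ =>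
      (integrable_exp_mul_sub_half_sq _).const_mul _, Finset.sum_mul]
    refine Finset.sum_congr rfl fun x _ => ?_
    rw [MeasureTheory.integral_const_mul, ← h1, mul_assoc]
  have h3 : ∀ z : ℝ, expect (biasedLaw p N) (fun x =>
      Real.exp ((c * a.centredPart p x) * z - z ^ 2 / 2)) ≤ Real.exp (-(1 / 4) * z ^ 2) := by
    intro z
    have : (fun x => Real.exp ((c * a.centredPart p x) * z - z ^ 2 / 2)) =
        fun x => Real.exp (-(z ^ 2 / 2)) * Real.exp ((c * z) * a.centredPart p x) := by
      funext x
      rw [← Real.exp_add]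
      ring_nf
    rw [this, expect_const_mul]
    refine (mul_le_mul_of_nonneg_left (expect_exp_centredPart_le hp0 hp1 a _)
      (Real.exp_pos _).le).trans ?_
    rw [← Real.exp_add]
    refine Real.exp_le_exp.2 ?_
    have : 2 * (c * z) ^ 2 * ∑ i, a.weights i ^ 2 ≤ 2 * (c * z) ^ 2 * s := by gcongr
    rw [mul_pow, hc2] at this
    have h4 : 2 * (1 / (8 * s) * z ^ 2) * s = z ^ 2 / 4 := by field_simp; ring
    rw [mul_pow, hc2]
    linarith
  have h4 : expect (biasedLaw p N) (fun x => Real.exp (a.centredPart p x ^ 2 / (16 * s))) *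
      √(2 * Real.pi) ≤ √(Real.pi / (1 / 4)) := by
    rw [h2, ← integral_gaussian]
    refine MeasureTheory.integral_mono ?_ (integrable_exp_neg_mul_sq (by norm_num)) h3
    simp only [expect]
    exact MeasureTheory.integrable_finsetSum _ fun x _ =>
      (integrable_exp_mul_sub_half_sq _).const_mul _
  refine le_of_mul_le_mul_right (h4.trans ?_) hpi
  rw [Real.sqrt_le_iff]
  refine ⟨by positivity, ?_⟩
  rw [mul_pow, Real.sq_sqrt (by positivity)]
  linarith [Real.pi_pos]

/-! ### Tails of the empirical mean squared error -/

theorem expect_sq_le_of_mem_Icc {b : ℝ} {f : Cube N → ℝ} (hf : ∀ x, f x ∈ Set.Icc (-b) b) :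
    expect (biasedLaw p N) (fun x => f x ^ 2) ≤ b ^ 2 :=
  expect_le_const _ fun x => sq_le_sq' (hf x).1 (hf x).2

/-- A bound for the ratio of the second moment of the squared loss and the squared error scale. -/
def lossMomentConst (p : ℝ) : ℝ := 8 + 256 * (1 + 576 / signVar p ^ 2)

theorem lossMomentConst_pos (hp0 : 0 < p) (hp1 : p < 1) : 0 < lossMomentConst p := by
  have := signVar_pos hp0 hp1
  unfold lossMomentConst
  positivity

theorem err_nonneg (hp0 : 0 < p) (hp1 : p < 1) (f : Cube N → ℝ) (a : Scores N) :
    0 ≤ err p f a := by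
  have h := residual_le_mse hp0 hp1 f a
  rw [mse_eq_residual_add_err hp0 hp1] at h
  linarith

/-- The fourth power is split among `f`, the mean and the centred part, each controlled by the
second moment of the datamodel. The point is the quadratic growth in the error, the same order as
the squared deviation allowed in the lower tail. -/
theorem expect_loss_sq_le (hp0 : 0 < p) (hp1 : p < 1) {b : ℝ} (hb : 0 < b) {f : Cube N → ℝ}
    (hf : ∀ x, f x ∈ Set.Icc (-b) b) (a : Scores N) :
    expect (biasedLaw p N) (fun x => ((f x - a.predict x) ^ 2) ^ 2) ≤
      lossMomentConst p * (err p f a + b ^ 2) ^ 2 := by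
  have hv := signVar_pos hp0 hp1
  have he := err_nonneg hp0 hp1 f a
  set Q := err p f a + b ^ 2 with hQ
  have hQ0 : 0 < Q := by positivity
  have hq : a.mean p ^ 2 + signVar p * ∑ i, a.weights i ^ 2 ≤ 2 * Q := by
    have := mean_sq_add_weights_sq_le hp0 hp1 f a
    have := expect_sq_le_of_mem_Icc (p := p) hf
    linarith
  have hw0 : 0 ≤ ∑ i, a.weights i ^ 2 := by positivity
  have hw : ∑ i, a.weights i ^ 2 ≤ 2 * Q / signVar p := by
    rw [le_div_iff₀ hv]; nlinarith [sq_nonneg (a.mean p)]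
  have hm : a.mean p ^ 4 ≤ (2 * Q) ^ 2 := by
    rw [show a.mean p ^ 4 = (a.mean p ^ 2) ^ 2 by ring]
    have : a.mean p ^ 2 ≤ 2 * Q := by nlinarith [mul_nonneg hv.le hw0]
    gcongr
  have h4 := expect_centredPart_pow_four_le hp0 hp1 a (s := 2 * Q / signVar p) (by positivity) hw
  have conv : ∀ u w : ℝ, (u + w) ^ 4 ≤ 8 * u ^ 4 + 8 * w ^ 4 := by
    intro u w
    have h1 : (u + w) ^ 2 ≤ 2 * (u ^ 2 + w ^ 2) := by nlinarith [sq_nonneg (u - w)]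
    have h2 : (u ^ 2 + w ^ 2) ^ 2 ≤ 2 * (u ^ 4 + w ^ 4) := by nlinarith [sq_nonneg (u ^ 2 - w ^ 2)]
    calc (u + w) ^ 4 = ((u + w) ^ 2) ^ 2 := by ring
      _ ≤ (2 * (u ^ 2 + w ^ 2)) ^ 2 := by gcongr
      _ ≤ _ := by nlinarith
  have hpt : ∀ x, ((f x - a.predict x) ^ 2) ^ 2 ≤
      (8 * Q ^ 2 + 64 * (2 * Q) ^ 2) + 64 * a.centredPart p x ^ 4 := by
    intro x
    have h1 := conv (f x) (-a.predict x)
    have h2 := conv (a.mean p) (a.centredPart p x)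
    rw [← Scores.predict_eq] at h2
    have h3 : f x ^ 4 ≤ Q ^ 2 := by
      have : f x ^ 2 ≤ Q := (sq_le_sq' (hf x).1 (hf x).2).trans (by linarith)
      rw [show f x ^ 4 = (f x ^ 2) ^ 2 by ring]
      gcongr
    calc ((f x - a.predict x) ^ 2) ^ 2 = (f x + -a.predict x) ^ 4 := by ring
      _ ≤ _ := h1
      _ ≤ _ := by rw [neg_pow, show (-1 : ℝ) ^ 4 = 1 by norm_num, one_mul]; linarith
  refine (expect_mono hpt).trans ?_
  rw [expect_add, expect_const, expect_const_mul]
  refine (add_le_add le_rfl (mul_le_mul_of_nonneg_left h4 (by norm_num))).trans (le_of_eq ?_)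
  rw [lossMomentConst]
  field_simp
  ring

theorem empirical_loss_lower_tail (hp0 : 0 < p) (hp1 : p < 1) {b : ℝ} (hb : 0 < b)
    {f : Cube N → ℝ} (hf : ∀ x, f x ∈ Set.Icc (-b) b) (a : Scores N) (m : ℕ) {ε : ℝ}
    (hε0 : 0 < ε) (hε1 : ε ≤ 1) (ha : ε ≤ err p f a) :
    (productLaw fun _ : Fin m => biasedLaw p N).toOuterMeasure
        {x | ∑ i, (f (x i) - a.predict (x i)) ^ 2 ≤
          m * (residual p f + 3 / 4 * err p f a)} ≤
      ENNReal.ofReal (Real.exp (-(m * (ε ^ 2 / (32 * lossMomentConst p * (1 + b ^ 2) ^ 2))))) := by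
  have hA := lossMomentConst_pos hp0 hp1
  have he : 0 < err p f a := hε0.trans_le ha
  have h := lower_tail_of_nonneg (biasedLaw p N) (fun x => (f x - a.predict x) ^ 2) m
    (V := lossMomentConst p * (err p f a + b ^ 2) ^ 2) (t := err p f a / 4)
    (fun x => sq_nonneg _) (by positivity) (expect_loss_sq_le hp0 hp1 hb hf a) (by positivity)
  have hmse : expect (biasedLaw p N) (fun x => (f x - a.predict x) ^ 2) =
    residual p f + err p f a := mse_eq_residual_add_err hp0 hp1 f a
  rw [hmse, show residual p f + err p f a - err p f a / 4 = residual p f + 3 / 4 * err p f a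
    by ring] at h
  refine h.trans (ENNReal.ofReal_le_ofReal (Real.exp_le_exp.2 (neg_le_neg ?_)))
  refine mul_le_mul_of_nonneg_left ?_ (Nat.cast_nonneg m)
  rw [div_le_div_iff₀ (by positivity) (by positivity)]
  -- The ratio `err / (err + b²)` stays above `ε / (1 + b²)`, so the rate is uniform over all scores
  -- of error at least `ε`.
  have h1 : ε * (err p f a + b ^ 2) ≤ err p f a * (1 + b ^ 2) := by
    have h2 : ε * err p f a ≤ 1 * err p f a := by gcongr
    have h3 : ε * b ^ 2 ≤ err p f a * b ^ 2 := by gcongr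
    linarith
  have h2 : (ε * (err p f a + b ^ 2)) ^ 2 ≤ (err p f a * (1 + b ^ 2)) ^ 2 := by gcongr
  nlinarith [mul_le_mul_of_nonneg_left h2 hA.le]

/-- The rate of exponential moments of the loss of the optimal datamodel. -/
def lossExpRate (p b : ℝ) : ℝ := signVar p / (256 * (b ^ 2 + 1))

theorem signVar_le_one (p : ℝ) : signVar p ≤ 1 := by
  unfold signVar; nlinarith [sq_nonneg (2 * p - 1)]

theorem lossExpRate_pos (hp0 : 0 < p) (hp1 : p < 1) (b : ℝ) : 0 < lossExpRate p b := by
  have := signVar_pos hp0 hp1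
  unfold lossExpRate; positivity

theorem lossExpRate_le_one (p b : ℝ) : lossExpRate p b ≤ 1 := by
  unfold lossExpRate
  rw [div_le_one (by positivity)]
  nlinarith [signVar_le_one p, sq_nonneg b]

/-- The optimal scores have zero error, hence second moment at most `2 b²`. The rate is small enough
that the bounded part of the loss contributes a factor at most `e ≤ 3` and the centred part one at
most `2`. The `+ 1` in `lossExpRate` keeps the rate below `1` for small `b`. -/
theorem expect_exp_optimal_loss_le (hp0 : 0 < p) (hp1 : p < 1) {b : ℝ} (hb : 0 < b)
    {f : Cube N → ℝ} (hf : ∀ x, f x ∈ Set.Icc (-b) b) :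
    expect (biasedLaw p N) (fun x => Real.exp (2 * lossExpRate p b *
      (f x - (optimalScores p f).predict x) ^ 2)) ≤ 6 := by
  set a := optimalScores p f with ha
  have hv := signVar_pos hp0 hp1
  have hl := lossExpRate_pos hp0 hp1 b
  have hq : a.mean p ^ 2 + signVar p * ∑ i, a.weights i ^ 2 ≤ 2 * b ^ 2 := by
    have h1 := mean_sq_add_weights_sq_le hp0 hp1 f a
    rw [ha, err_optimalScores, ← ha] at h1
    have := expect_sq_le_of_mem_Icc (p := p) hf
    linarith
  have hw0 : 0 ≤ ∑ i, a.weights i ^ 2 := by positivity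
  have hw : ∑ i, a.weights i ^ 2 ≤ 2 * b ^ 2 / signVar p := by
    rw [le_div_iff₀ hv]; nlinarith [sq_nonneg (a.mean p)]
  have hm : a.mean p ^ 2 ≤ 2 * b ^ 2 := by nlinarith [mul_nonneg hv.le hw0]
  have h := expect_exp_centredPart_sq_le hp0 hp1 a (s := 2 * b ^ 2 / signVar p) (by positivity) hw
  have hpt : ∀ x, Real.exp (2 * lossExpRate p b * (f x - a.predict x) ^ 2) ≤
      3 * Real.exp (a.centredPart p x ^ 2 / (16 * (2 * b ^ 2 / signVar p))) := by
    intro x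
    -- Twice `(u + w)² ≤ 2 u² + 2 w²`: the bounded part is `2 b² + 4 · 2 b²`.
    have h1 : (f x - a.predict x) ^ 2 ≤ 10 * b ^ 2 + 4 * a.centredPart p x ^ 2 := by
      rw [Scores.predict_eq (p := p)]
      have := sq_le_sq' (hf x).1 (hf x).2
      nlinarith [sq_nonneg (f x + (a.mean p + a.centredPart p x)),
        sq_nonneg (a.mean p - a.centredPart p x)]
    have h2 : 2 * lossExpRate p b * (10 * b ^ 2) ≤ 1 := by
      rw [lossExpRate]
      have h3 : 2 * (signVar p / (256 * (b ^ 2 + 1))) * (10 * b ^ 2) =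
        signVar p * 20 * b ^ 2 / (256 * (b ^ 2 + 1)) := by ring
      rw [h3, div_le_one (by positivity)]
      nlinarith [signVar_le_one p, sq_nonneg b]
    have h3 : 2 * lossExpRate p b * (4 * a.centredPart p x ^ 2) ≤
        a.centredPart p x ^ 2 / (16 * (2 * b ^ 2 / signVar p)) := by
      have h4 : a.centredPart p x ^ 2 / (16 * (2 * b ^ 2 / signVar p)) =
        signVar p / (256 * b ^ 2) * (8 * a.centredPart p x ^ 2) := by field_simp; ring
      have h5 : lossExpRate p b ≤ signVar p / (256 * b ^ 2) := by
        unfold lossExpRate; gcongr; linarith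
      rw [h4]
      nlinarith [mul_le_mul_of_nonneg_right h5 (sq_nonneg (a.centredPart p x))]
    calc Real.exp (2 * lossExpRate p b * (f x - a.predict x) ^ 2)
        ≤ Real.exp (1 + a.centredPart p x ^ 2 / (16 * (2 * b ^ 2 / signVar p))) := by
          refine Real.exp_le_exp.2 ?_
          have := mul_le_mul_of_nonneg_left h1 (mul_pos two_pos hl).le
          linarith
      _ ≤ _ := by
          rw [Real.exp_add]
          gcongr
          exact Real.exp_one_lt_d9.le.trans (by norm_num)
  refine (expect_mono hpt).trans ?_
  rw [expect_const_mul]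
  linarith

theorem empirical_optimal_loss_upper_tail (hp0 : 0 < p) (hp1 : p < 1) {b : ℝ} (hb : 0 < b)
    {f : Cube N → ℝ} (hf : ∀ x, f x ∈ Set.Icc (-b) b) (m : ℕ) {ε : ℝ} (hε0 : 0 < ε) (hε1 : ε ≤ 1) :
    (productLaw fun _ : Fin m => biasedLaw p N).toOuterMeasure
        {x | m * (residual p f + ε / 4) ≤
          ∑ i, (f (x i) - (optimalScores p f).predict (x i)) ^ 2} ≤
      ENNReal.ofReal (Real.exp (-(m * (ε ^ 2 * lossExpRate p b ^ 2 / 768)))) := by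
  have h := upper_tail_of_exp_moment (biasedLaw p N)
    (fun x => (f x - (optimalScores p f).predict x) ^ 2) m (A := 6) (s := ε / 4)
    (fun x => sq_nonneg _) (lossExpRate_pos hp0 hp1 b) (lossExpRate_le_one p b) (by norm_num)
    (expect_exp_optimal_loss_le hp0 hp1 hb hf) (by positivity) (by linarith)
  have hmse : expect (biasedLaw p N) (fun x => (f x - (optimalScores p f).predict x) ^ 2) =
    residual p f := mse_optimalScores hp0 hp1 f
  rw [hmse] at h
  refine h.trans_eq ?_
  congr 4
  ring

end

/-! ### The non-negative quadratic fit -/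

theorem fitLoss_eq (ρ : ℝ) (y z : Fin 3 → ℝ) :
    fitLoss ρ y z = (z 0 - y 0) ^ 2 + (z 0 + ρ * z 1 + ρ ^ 2 * z 2 - y 1) ^ 2 +
      (z 0 + 2 * ρ * z 1 + 4 * ρ ^ 2 * z 2 - y 2) ^ 2 := by
  simp [fitLoss, Fin.sum_univ_three, Matrix.mulVec, dotProduct]

/-- Compactness: a nonnegative point no worse than `0` lies in a box, since its first two residuals
bound the nonnegative terms `w₀`, `ρ w₁` and `ρ² w₂`. This makes the choice in `nonnegFit`
meaningful. -/
theorem exists_nonneg_fitLoss_le {ρ : ℝ} (hρ : 0 < ρ) (y : Fin 3 → ℝ) :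
    ∃ z, 0 ≤ z ∧ ∀ w, 0 ≤ w → fitLoss ρ y z ≤ fitLoss ρ y w := by
  set L := fitLoss ρ y 0 with hL
  have hL0 : 0 ≤ L := Finset.sum_nonneg fun i _ => sq_nonneg _
  set T := |y 0| + |y 1| + L + 1 with hT
  have hT0 : 0 ≤ T := by positivity
  have hcont : Continuous (fitLoss ρ y) := by
    have : fitLoss ρ y = fun z => fitLoss ρ y z := rfl
    rw [this]
    simp only [fitLoss_eq]
    fun_prop
  let C : Fin 3 → ℝ := ![T, T / ρ, T / ρ ^ 2]
  have hC : 0 ≤ C := by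
    intro i
    fin_cases i <;> simp [C] <;> positivity
  obtain ⟨z, hz, hmin⟩ := (isCompact_Icc (a := 0) (b := C)).exists_isMinOn
    ⟨0, Set.left_mem_Icc.2 hC⟩ hcont.continuousOn
  refine ⟨z, hz.1, fun w hw => ?_⟩
  by_cases hwL : fitLoss ρ y w ≤ L
  · refine hmin ⟨hw, ?_⟩
    rw [fitLoss_eq] at hwL
    have w0 := hw 0
    have w1 := hw 1
    have w2 := hw 2
    simp only [Pi.zero_apply] at w0 w1 w2
    have hbd : ∀ u : ℝ, u ^ 2 ≤ L → u ≤ L + 1 := fun u hu => by nlinarith [sq_nonneg (u - 1)]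
    have s0 := sq_nonneg (w 0 - y 0)
    have s1 := sq_nonneg (w 0 + ρ * w 1 + ρ ^ 2 * w 2 - y 1)
    have s2 := sq_nonneg (w 0 + 2 * ρ * w 1 + 4 * ρ ^ 2 * w 2 - y 2)
    have h0 := hbd (w 0 - y 0) (by linarith)
    have h1 := hbd (w 0 + ρ * w 1 + ρ ^ 2 * w 2 - y 1) (by linarith)
    have hy0 := le_abs_self (y 0)
    have hy1 := le_abs_self (y 1)
    have hy0' := abs_nonneg (y 0)
    have hy1' := abs_nonneg (y 1)
    have p1 : 0 ≤ ρ * w 1 := by positivity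
    have p2 : 0 ≤ ρ ^ 2 * w 2 := by positivity
    intro i
    fin_cases i
    · simp only [C, Fin.zero_eta, Matrix.cons_val_zero]
      linarith
    · simp only [C, Fin.mk_one, Matrix.cons_val_one, Matrix.cons_val_zero]
      rw [le_div_iff₀ hρ]
      linarith
    · simp only [C, Fin.reduceFinMk, Matrix.cons_val]
      rw [le_div_iff₀ (by positivity)]
      linarith
  · exact (hmin (Set.left_mem_Icc.2 hC)).trans (not_le.1 hwL).le

theorem nonnegFit_spec {ρ : ℝ} (hρ : 0 < ρ) (y : Fin 3 → ℝ) :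
    0 ≤ nonnegFit ρ y ∧ ∀ w, 0 ≤ w → fitLoss ρ y (nonnegFit ρ y) ≤ fitLoss ρ y w :=
  Classical.epsilon_spec (exists_nonneg_fitLoss_le hρ y)

/-- Since `z` is an admissible competitor, the fit has loss at most `3 D²`, hence residuals at most
`2 D` and node values within `3 D` of those of `z`. The linear coefficient is recovered by a finite
difference, which amplifies by `1/ρ`. -/
theorem abs_nonnegFit_sub_le {ρ D : ℝ} (hρ : 0 < ρ) (hρ1 : ρ ≤ 1 / 2) {y z : Fin 3 → ℝ}
    (hz : 0 ≤ z) (h0 : |z 0 - y 0| ≤ D) (h1 : |z 0 + ρ * z 1 + ρ ^ 2 * z 2 - y 1| ≤ D)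
    (h2 : |z 0 + 2 * ρ * z 1 + 4 * ρ ^ 2 * z 2 - y 2| ≤ D) :
    |nonnegFit ρ y 0 + nonnegFit ρ y 1 - (z 0 + z 1)| ≤ 15 * D / ρ := by
  have hD : 0 ≤ D := (abs_nonneg _).trans h0
  have hle := (nonnegFit_spec hρ y).2 z hz
  set w := nonnegFit ρ y
  rw [fitLoss_eq, fitLoss_eq] at hle
  have hsq : ∀ u : ℝ, |u| ≤ D → u ^ 2 ≤ D ^ 2 := fun u hu => sq_le_sq' (neg_le_of_abs_le hu)
    (le_of_abs_le hu)
  have hbd : ∀ u : ℝ, u ^ 2 ≤ 3 * D ^ 2 → |u| ≤ 2 * D := fun u hu =>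
    abs_le_of_sq_le_sq (by nlinarith) (by positivity)
  have s0 := hsq _ h0
  have s1 := hsq _ h1
  have s2 := hsq _ h2
  set e0 := w 0 - y 0 with he0
  set e1 := w 0 + ρ * w 1 + ρ ^ 2 * w 2 - y 1 with he1
  set e2 := w 0 + 2 * ρ * w 1 + 4 * ρ ^ 2 * w 2 - y 2 with he2
  have b0 := abs_le.1 (hbd e0 (by nlinarith [sq_nonneg e1, sq_nonneg e2]))
  have b1 := abs_le.1 (hbd e1 (by nlinarith [sq_nonneg e0, sq_nonneg e2]))
  have b2 := abs_le.1 (hbd e2 (by nlinarith [sq_nonneg e0, sq_nonneg e1]))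
  rw [abs_le] at h0 h1 h2
  have habs : ∀ u : ℝ, |u| * ρ = |u * ρ| := fun u => by rw [abs_mul, abs_of_pos hρ]
  rw [le_div_iff₀ hρ, habs, abs_le]
  -- The three-point forward difference `(-3, 4, -1) / 2` is exact on quadratics. The total is at
  -- most `3D/2 + 8 · 3D / 2 ≤ 15 D`.
  have hid : (w 0 + w 1 - (z 0 + z 1)) * ρ = ρ * (w 0 - z 0) +
      (-3 * (w 0 - z 0) + 4 * ((w 0 + ρ * w 1 + ρ ^ 2 * w 2) - (z 0 + ρ * z 1 + ρ ^ 2 * z 2)) -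
        ((w 0 + 2 * ρ * w 1 + 4 * ρ ^ 2 * w 2) - (z 0 + 2 * ρ * z 1 + 4 * ρ ^ 2 * z 2))) / 2 := by
    ring
  have g1 : ρ * (w 0 - z 0) ≤ 1 / 2 * (3 * D) := by
    refine (mul_le_mul_of_nonneg_left (show w 0 - z 0 ≤ 3 * D by linarith) hρ.le).trans ?_
    gcongr
  have g2 : -(1 / 2 * (3 * D)) ≤ ρ * (w 0 - z 0) := by
    have : ρ * (-(w 0 - z 0)) ≤ 1 / 2 * (3 * D) := by
      refine (mul_le_mul_of_nonneg_left (show -(w 0 - z 0) ≤ 3 * D by linarith) hρ.le).trans ?_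
      gcongr
    linarith
  rw [hid]
  constructor <;> linarith

/-! ### The quadratic approximation of the noise stability -/

section

variable {p : ℝ} {N : ℕ}

/-- The share of the sets with `j` elements in the second moment of `f`. -/
def levelWeight (p : ℝ) (f : Cube N → ℝ) (j : ℕ) : ℝ :=
  ∑ S : Finset (Fin N), if S.card = j then fourierWeight p f S else 0

theorem levelWeight_zero (f : Cube N → ℝ) : levelWeight p f 0 = fourierWeight p f ∅ := by
  simp [levelWeight, Finset.card_eq_zero]

theorem levelWeight_one (f : Cube N → ℝ) : levelWeight p f 1 = ∑ i, fourierWeight p f {i} := by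
  rw [levelWeight, ← Finset.sum_filter]
  have : (Finset.univ.filter fun S : Finset (Fin N) => S.card = 1) =
      Finset.univ.map ⟨fun i => {i}, Finset.singleton_injective⟩ := by
    ext S
    simp [Finset.card_eq_one, eq_comm]
  rw [this, Finset.sum_map]
  rfl

theorem levelWeight_nonneg (hp0 : 0 < p) (hp1 : p < 1) (f : Cube N → ℝ) (j : ℕ) :
    0 ≤ levelWeight p f j :=
  Finset.sum_nonneg fun S _ => by
    split_ifs
    exacts [fourierWeight_nonneg hp0 hp1 f S, le_rfl]

/-- Only sets of at least three elements are left out; each carries a factor at most `ρ³`, and all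
weights sum to at most `b²`. -/
theorem abs_levelWeight_sub_stability_le (hp0 : 0 < p) (hp1 : p < 1) {b ρ : ℝ} {f : Cube N → ℝ}
    (hf : ∀ x, f x ∈ Set.Icc (-b) b) (hρ0 : 0 ≤ ρ) (hρ1 : ρ ≤ 1) :
    |levelWeight p f 0 + ρ * levelWeight p f 1 + ρ ^ 2 * levelWeight p f 2 -
      expect (correlatedPairLaw p ρ N) (fun q => f q.1 * f q.2)| ≤ ρ ^ 3 * b ^ 2 := by
  have h1 : expect (correlatedPairLaw p ρ N) (fun q => f q.1 * f q.2) -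
      (levelWeight p f 0 + ρ * levelWeight p f 1 + ρ ^ 2 * levelWeight p f 2) =
      ∑ S : Finset (Fin N), if 3 ≤ S.card then ρ ^ S.card * fourierWeight p f S else 0 := by
    rw [expect_correlatedPairLaw hp0 hp1 hρ0 hρ1]
    simp only [levelWeight, Finset.mul_sum, ← Finset.sum_add_distrib, ← Finset.sum_sub_distrib]
    refine Finset.sum_congr rfl fun S _ => ?_
    obtain h | h | h | h : S.card = 0 ∨ S.card = 1 ∨ S.card = 2 ∨ 3 ≤ S.card := by omega
    · simp [h]
    · simp [h]
    · simp [h]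
    · simp [h, show S.card ≠ 0 by omega, show S.card ≠ 1 by omega, show S.card ≠ 2 by omega]
  have hw := fourierWeight_nonneg hp0 hp1 f
  rw [abs_sub_comm, h1, abs_of_nonneg (Finset.sum_nonneg fun S _ => by
    have := hw S
    split_ifs <;> positivity)]
  calc _ ≤ ∑ S : Finset (Fin N), ρ ^ 3 * fourierWeight p f S := by
        refine Finset.sum_le_sum fun S _ => ?_
        have := hw S
        split_ifs with h
        · exact mul_le_mul_of_nonneg_right (pow_le_pow_of_le_one hρ0 hρ1 h) this
        · positivity
    _ = ρ ^ 3 * expect (biasedLaw p N) (fun x => f x ^ 2) := by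
        rw [parseval hp0 hp1, Finset.mul_sum]
    _ ≤ _ := by
        have := expect_sq_le_of_mem_Icc (p := p) hf
        gcongr

/-! ### Accuracy of the residual estimate -/

theorem abs_mul_sub_mul_le {b u u' w w' : ℝ} (hu : |u| ≤ b) (hu' : |u'| ≤ b) (hw : |w| ≤ b)
    (hw' : |w'| ≤ b) : |u * u' - w * w'| ≤ 2 * b ^ 2 := by
  have hb : 0 ≤ b := (abs_nonneg _).trans hu
  calc |u * u' - w * w'| ≤ |u * u'| + |w * w'| := abs_sub _ _
    _ = |u| * |u'| + |w| * |w'| := by rw [abs_mul, abs_mul]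
    _ ≤ b * b + b * b := by gcongr
    _ = _ := by ring

open Classical in
theorem sum_slot_indicator {n : ℕ} (v u : Slot n → ℝ) :
    ((Finset.univ.filter fun t => v t ≠ u t).card : ℝ) =
      ∑ j : Fin 3, ∑ e : Fin n, ((if v (.inl (j, e, true)) ≠ u (.inl (j, e, true)) then 1 else 0) +
        (if v (.inl (j, e, false)) ≠ u (.inl (j, e, false)) then 1 else 0)) +
      ∑ e : Fin n, if v (.inr e) ≠ u (.inr e) then 1 else 0 := by
  rw [Finset.card_filter]
  push_cast
  rw [Fintype.sum_sum_type, Fintype.sum_prod_type]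
  simp only [Fintype.sum_prod_type, Fintype.sum_bool]

-- A product changes by at most `2 b²`, and only if one of its two slots is wrong, so each change
-- can be charged to a wrong slot.
open Classical in
theorem abs_pair_sum_sub_le {n : ℕ} {b : ℝ} {v u : Slot n → ℝ} (hv : ∀ t, |v t| ≤ b)
    (hu : ∀ t, |u t| ≤ b) (j : Fin 3) :
    |∑ e : Fin n, v (.inl (j, e, false)) * v (.inl (j, e, true)) -
      ∑ e : Fin n, u (.inl (j, e, false)) * u (.inl (j, e, true))| ≤
        2 * b ^ 2 * (Finset.univ.filter fun t => v t ≠ u t).card := by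
  set F : Fin 3 → Fin n → ℝ := fun j e =>
    ((if v (.inl (j, e, true)) ≠ u (.inl (j, e, true)) then 1 else 0) +
        (if v (.inl (j, e, false)) ≠ u (.inl (j, e, false)) then 1 else 0)) with hF
  have hF0 : ∀ j e, 0 ≤ F j e := fun j e => by
    simp only [hF]; split_ifs <;> norm_num
  have h1 : ∑ e, F j e ≤ ((Finset.univ.filter fun t => v t ≠ u t).card : ℝ) := by
    rw [sum_slot_indicator]
    refine le_add_of_le_of_nonneg ?_ (Finset.sum_nonneg fun e _ => by split_ifs <;> norm_num)
    exact Finset.single_le_sum (f := fun j => ∑ e, F j e)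
      (fun j _ => Finset.sum_nonneg fun e _ => hF0 j e) (Finset.mem_univ j)
  rw [← Finset.sum_sub_distrib]
  refine (Finset.abs_sum_le_sum_abs _ _).trans ?_
  refine le_trans ?_ (mul_le_mul_of_nonneg_left h1 (by positivity))
  rw [Finset.mul_sum]
  refine Finset.sum_le_sum fun e _ => ?_
  have hb := abs_mul_sub_mul_le (hv (.inl (j, e, false))) (hv (.inl (j, e, true)))
    (hu (.inl (j, e, false))) (hu (.inl (j, e, true)))
  have hb2 : 0 ≤ 2 * b ^ 2 := by positivity
  simp only [hF]
  split_ifs with h h' h'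
  · linarith
  · linarith
  · linarith
  · rw [not_not.1 h, not_not.1 h']; simp

open Classical in
theorem abs_single_sum_sub_le {n : ℕ} {b : ℝ} {v u : Slot n → ℝ} (hv : ∀ t, |v t| ≤ b)
    (hu : ∀ t, |u t| ≤ b) :
    |∑ e : Fin n, v (.inr e) ^ 2 - ∑ e : Fin n, u (.inr e) ^ 2| ≤
        2 * b ^ 2 * (Finset.univ.filter fun t => v t ≠ u t).card := by
  have h1 : (∑ e : Fin n, if v (.inr e) ≠ u (.inr e) then (1 : ℝ) else 0) ≤
      ((Finset.univ.filter fun t => v t ≠ u t).card : ℝ) := by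
    rw [sum_slot_indicator]
    refine le_add_of_nonneg_left (Finset.sum_nonneg fun j _ => Finset.sum_nonneg fun e _ => ?_)
    split_ifs <;> norm_num
  rw [← Finset.sum_sub_distrib]
  refine (Finset.abs_sum_le_sum_abs _ _).trans ?_
  refine le_trans ?_ (mul_le_mul_of_nonneg_left h1 (by positivity))
  rw [Finset.mul_sum]
  refine Finset.sum_le_sum fun e _ => ?_
  split_ifs with h
  · rw [sq, sq, mul_one]
    exact abs_mul_sub_mul_le (hv _) (hv _) (hu _) (hu _)
  · rw [not_not.1 h]; simp

theorem abs_div_sub_le_of_abs_sub_le {n : ℕ} (hn : 0 < n) {s s' e τ : ℝ}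
    (h : |s' - s| ≤ n * τ) (h' : |s - n * e| ≤ n * τ) : |e - s' / n| ≤ 2 * τ := by
  have hn' : (0 : ℝ) < n := by exact_mod_cast hn
  have : e - s' / n = -((s' - s) + (s - n * e)) / n := by field_simp; ring
  rw [this, abs_div, abs_neg, abs_of_pos hn', div_le_iff₀ hn']
  have := abs_add_le (s' - s) (s - n * e)
  linarith

-- Here `u` are the true values and `v` the received ones. Sampling and corruption each cost `τ` per
-- average, and truncation costs at most `(2ρ)³ b²`.
open Classical in
theorem abs_residualEstimate_sub_le (hp0 : 0 < p) (hp1 : p < 1) {b ε ρ τ : ℝ} {f : Cube N → ℝ}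
    (hf : ∀ x, f x ∈ Set.Icc (-b) b) (hε : 0 < ε) (hρ : 0 < ρ) (hρ1 : ρ ≤ 1 / 2)
    (hbias : 120 * b ^ 2 * ρ ^ 2 ≤ ε / 24) (hτ : τ = ε * ρ / 360) {n : ℕ} (hn : 0 < n)
    {u v : Slot n → ℝ} (hu : ∀ t, |u t| ≤ b) (hv : ∀ t, |v t| ≤ b)
    (hpairs : ∀ j : Fin 3, |∑ e : Fin n, u (.inl (j, e, false)) * u (.inl (j, e, true)) -
      n * expect (correlatedPairLaw p (![0, ρ, 2 * ρ] j) N) (fun q => f q.1 * f q.2)| ≤ n * τ)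
    (hsingles : |∑ e : Fin n, u (.inr e) ^ 2 -
      n * expect (biasedLaw p N) (fun x => f x ^ 2)| ≤ n * τ)
    (hbad : 2 * b ^ 2 * (Finset.univ.filter fun t => v t ≠ u t).card ≤ n * τ) :
    |residualEstimate ρ n v - residual p f| ≤ ε / 4 := by
  set y : Fin 3 → ℝ := fun j =>
    (∑ e : Fin n, v (.inl (j, e, false)) * v (.inl (j, e, true))) / n with hy
  have hpair : ∀ j, |expect (correlatedPairLaw p (![0, ρ, 2 * ρ] j) N) (fun q => f q.1 * f q.2) -
      y j| ≤ 2 * τ := fun j =>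
    abs_div_sub_le_of_abs_sub_le hn ((abs_pair_sum_sub_le hv hu j).trans hbad) (hpairs j)
  have hsingle := abs_div_sub_le_of_abs_sub_le hn ((abs_single_sum_sub_le hv hu).trans hbad)
    hsingles
  let z : Fin 3 → ℝ := fun j => levelWeight p f j
  have hz : 0 ≤ z := fun j => levelWeight_nonneg hp0 hp1 f j
  have t0 := abs_levelWeight_sub_stability_le hp0 hp1 hf le_rfl zero_le_one
  have t1 := abs_levelWeight_sub_stability_le hp0 hp1 hf hρ.le (by linarith)
  have t2 := abs_levelWeight_sub_stability_le hp0 hp1 hf (by linarith : 0 ≤ 2 * ρ) (by linarith)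
  have p0 := hpair 0
  have p1 := hpair 1
  have p2 := hpair 2
  simp only [Matrix.cons_val_zero, Matrix.cons_val_one, Matrix.cons_val] at p0 p1 p2
  have hb3 : 0 ≤ ρ ^ 3 * b ^ 2 := by positivity
  have hfit := abs_nonnegFit_sub_le hρ hρ1 (D := 2 * τ + 8 * (ρ ^ 3 * b ^ 2)) (y := y) hz
    (by
      have := abs_add_le _ _ |>.trans (add_le_add t0 p0)
      simp only [z, Fin.val_zero]
      refine le_trans (le_of_eq ?_) (this.trans ?_)
      · congr 1; ring
      · nlinarith)
    (by
      have := abs_add_le _ _ |>.trans (add_le_add t1 p1)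
      simp only [z, Fin.val_zero, Fin.val_one, Fin.val_two]
      refine le_trans (le_of_eq ?_) (this.trans ?_)
      · congr 1; ring
      · nlinarith)
    (by
      have := abs_add_le _ _ |>.trans (add_le_add t2 p2)
      simp only [z, Fin.val_zero, Fin.val_one, Fin.val_two]
      refine le_trans (le_of_eq ?_) (this.trans ?_)
      · congr 1; ring
      · nlinarith)
  -- Budget: `ε/12` from `30 τ / ρ` and `ε/24` from the bias. The second moment takes the other
  -- `ε/8`.
  have hD : 15 * (2 * τ + 8 * (ρ ^ 3 * b ^ 2)) / ρ ≤ ε / 8 := by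
    have : 15 * (2 * τ + 8 * (ρ ^ 3 * b ^ 2)) / ρ = ε / 12 + 120 * b ^ 2 * ρ ^ 2 := by
      rw [hτ]; field_simp; ring
    linarith
  have hτ2 : 2 * τ ≤ ε / 8 := by rw [hτ]; nlinarith
  have hz0 : z 0 = fourierWeight p f ∅ := levelWeight_zero f
  have hz1 : z 1 = ∑ i, fourierWeight p f {i} := levelWeight_one f
  have hest : residualEstimate ρ n v =
    (∑ e : Fin n, v (.inr e) ^ 2) / n - nonnegFit ρ y 0 - nonnegFit ρ y 1 := rfl
  rw [hest, residual, ← hz0, ← hz1]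
  have h1 := abs_le.1 (hfit.trans hD)
  have h2 := abs_le.1 (hsingle.trans hτ2)
  rw [abs_le]
  constructor <;> linarith [h1.1, h1.2, h2.1, h2.2]

end

/-! ### Spot-checks -/

/-- Drawing without replacement misses a set of size `t` no more often than with replacement: factor
by factor, `(M - t - k) / (M - k) ≤ (M - t) / M`, cross-multiplied for truncated subtraction. -/
theorem descFactorial_sub_mul_pow_le (M t k : ℕ) :
    (M - t).descFactorial k * M ^ k ≤ M.descFactorial k * (M - t) ^ k := by
  induction k with
  | zero => simp
  | succ k ih =>
    have h : (M - t - k) * M ≤ (M - k) * (M - t) := by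
      obtain h | h := le_or_gt (M - t) k
      · simp [Nat.sub_eq_zero_of_le h]
      · obtain ⟨d, rfl⟩ : ∃ d, M = t + k + d := ⟨M - t - k, by omega⟩
        rw [show t + k + d - t - k = d by omega, show t + k + d - k = t + d by omega,
          show t + k + d - t = k + d by omega]
        nlinarith [Nat.zero_le (t * k)]
    calc (M - t).descFactorial (k + 1) * M ^ (k + 1)
        = ((M - t - k) * M) * ((M - t).descFactorial k * M ^ k) := by
          rw [Nat.descFactorial_succ]; ring
      _ ≤ ((M - k) * (M - t)) * (M.descFactorial k * (M - t) ^ k) := Nat.mul_le_mul h ih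
      _ = _ := by rw [Nat.descFactorial_succ]; ring

theorem choose_sub_mul_pow_le (M t k : ℕ) :
    (M - t).choose k * M ^ k ≤ M.choose k * (M - t) ^ k := by
  have h := descFactorial_sub_mul_pow_le M t k
  rw [Nat.descFactorial_eq_factorial_mul_choose, Nat.descFactorial_eq_factorial_mul_choose,
    mul_assoc, mul_assoc] at h
  exact Nat.le_of_mul_le_mul_left h (Nat.factorial_pos k)

theorem card_slot (n : ℕ) : Fintype.card (Slot n) = 7 * n := by
  simp; ring

/-- The miss probability is a ratio of binomials, at most `(1 - |B|/M)^k` with `M = 7 n` slots. -/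
theorem spotLaw_disjoint_le {n : ℕ} (hn : 0 < n) (k : ℕ) (B : Finset (Slot n)) :
    (spotLaw n k).toOuterMeasure {s | Disjoint s B} ≤
      ENNReal.ofReal (Real.exp (-(k * B.card / (7 * n)))) := by
  classical
  obtain rfl | hB := B.eq_empty_or_nonempty
  · simpa only [Finset.card_empty, Nat.cast_zero, mul_zero, zero_div, neg_zero, Real.exp_zero,
      ENNReal.ofReal_one] using toOuterMeasure_le_one _ _
  set M := Fintype.card (Slot n) with hM
  have hM7 : (M : ℝ) = 7 * n := by rw [hM, card_slot]; push_cast; rfl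
  have hMpos : (0 : ℝ) < M := by rw [hM7]; positivity
  have hcardB : B.card ≤ M := Finset.card_le_univ B
  rw [spotLaw, PMF.toOuterMeasure_uniformOfFinset_apply, Finset.card_powersetCard,
    Finset.card_univ]
  have hfilter : ∀ _ : DecidablePred (· ∈ {s : Finset (Slot n) | Disjoint s B}),
      ((Finset.powersetCard (min k M) (Finset.univ : Finset (Slot n))).filter
        (· ∈ {s : Finset (Slot n) | Disjoint s B})) = Finset.powersetCard (min k M) Bᶜ := by
    intro _
    ext s
    simp [Finset.mem_powersetCard, Finset.subset_compl_iff_disjoint_right, and_comm]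
  rw [← hM]
  simp only [hfilter]
  rw [Finset.card_powersetCard, Finset.card_compl, ← hM]
  obtain hk | hk := le_total k M
  · rw [min_eq_left hk]
    have hpos : 0 < M.choose k := Nat.choose_pos hk
    have h := choose_sub_mul_pow_le M B.card k
    have h' : ((M - B.card).choose k : ℝ) * (M : ℝ) ^ k ≤
        (M.choose k : ℝ) * ((M : ℝ) - B.card) ^ k := by
      rw [← Nat.cast_sub hcardB]; exact_mod_cast h
    rw [← ENNReal.ofReal_natCast, ← ENNReal.ofReal_natCast (M.choose k),
      ← ENNReal.ofReal_div_of_pos (by exact_mod_cast hpos)]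
    refine ENNReal.ofReal_le_ofReal ?_
    have hpos' : (0 : ℝ) < M.choose k := by exact_mod_cast hpos
    have hle : ((M : ℝ) - B.card) / M ≤ Real.exp (-(B.card / M)) := by
      rw [sub_div, div_self hMpos.ne']
      linarith [Real.one_sub_le_exp_neg ((B.card : ℝ) / M)]
    have h0 : 0 ≤ ((M : ℝ) - B.card) / M := by
      have : (B.card : ℝ) ≤ M := by exact_mod_cast hcardB
      exact div_nonneg (by linarith) hMpos.le
    calc ((M - B.card).choose k : ℝ) / M.choose k ≤ (((M : ℝ) - B.card) / M) ^ k := by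
          rw [div_pow, div_le_div_iff₀ hpos' (by positivity)]
          linarith
      _ ≤ Real.exp (-(B.card / M)) ^ k := pow_le_pow_left₀ h0 hle k
      _ = _ := by rw [← Real.exp_nat_mul, hM7]; congr 1; ring
  -- Every slot is inspected, so a nonempty `B` cannot be missed.
  · rw [min_eq_right hk, Nat.choose_eq_zero_of_lt (Nat.sub_lt (by exact_mod_cast hMpos)
      (Finset.card_pos.2 hB))]
    simp

/-! ### Runs of the verifier -/

section Runs

variable {Seed Θ : Type*} {b : ℝ} {N : ℕ}

theorem run_trainAll {Q Θ α : Type*} (train : Q → Θ) (m : ℕ) (q : Fin m → Q)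
    (next : (Fin m → Θ) → TrainingProgram Q Θ α) :
    (TrainingProgram.trainAll m q next).run train =
      (((next fun i => train (q i)).run train).1, ((next fun i => train (q i)).run train).2 + m) := by
  induction m with
  | zero =>
    rw [TrainingProgram.trainAll, Subsingleton.elim (fun i => train (q i)) Fin.elim0]
    rfl
  | succ m ih =>
    have hcons : (Fin.cons (train (q 0)) fun i => train (q i.succ) : Fin (m + 1) → Θ) =
        fun i => train (q i) := by
      funext i
      refine Fin.cases ?_ (fun i => ?_) i <;> simp
    rw [TrainingProgram.trainAll, TrainingProgram.run, ih, hcons]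
    simp only [Prod.mk.injEq, true_and]
    ring

variable (M : ModelClass Seed Θ b) {n : ℕ} (c : Challenge N n Seed) (models : Slot n → Θ)
  (next : TrainingProgram (Cube N × Seed) Θ (Option (Scores N))) (train : Cube N × Seed → Θ)

theorem run_spotCheck_of_forall (l : List (Slot n))
    (h : ∀ s ∈ l, M.checkEquiv (train (c.subset s, c.seeds s)) (models s)) :
    ((spotCheck M c models next l).run train).1 = (next.run train).1 := by
  induction l with
  | nil => rfl
  | cons s l ih =>
    rw [spotCheck, TrainingProgram.run, if_pos (h s (by simp))]
    exact ih fun t ht => h t (by simp [ht])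

theorem run_spotCheck_of_exists (l : List (Slot n))
    (h : ∃ s ∈ l, ¬ M.checkEquiv (train (c.subset s, c.seeds s)) (models s)) :
    ((spotCheck M c models next l).run train).1 = none := by
  induction l with
  | nil => simp at h
  | cons s l ih =>
    rw [spotCheck, TrainingProgram.run]
    split_ifs with hs
    · refine ih ?_
      obtain ⟨t, ht, htn⟩ := h
      rcases List.mem_cons.1 ht with rfl | ht
      · exact absurd hs htn
      · exact ⟨t, ht, htn⟩
    · rfl

theorem run_spotCheck_trainings_le (l : List (Slot n)) :
    ((spotCheck M c models next l).run train).2 ≤ l.length + (next.run train).2 := by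
  induction l with
  | nil => simp [spotCheck]
  | cons s l ih =>
    rw [spotCheck, TrainingProgram.run, List.length_cons]
    split_ifs
    · simp only []
      omega
    · simp only [TrainingProgram.run]
      omega

end Runs

/-! ### The interaction -/

section Interaction

variable {Seed Θ : Type*} {b : ℝ} {N : ℕ}

/-- The secret that does not concern the challenge can be drawn after the reply. -/
theorem interact_spotCheckVerifier_eq (M : ModelClass Seed Θ b) (p ε : ℝ) (π : Parameters)
    (train : Cube N → Seed → Θ) (P : Prover (Challenge N π.n Seed) (Reply N π.n Θ)) :
    interact train (spotCheckVerifier M p ε N π) P =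
      (productLaw fun s : Fin 3 × Fin π.n =>
        correlatedPairLaw p (![0, π.ρ, 2 * π.ρ] s.1) N).bind fun pairs =>
      (productLaw fun _ : Fin π.n => biasedLaw p N).bind fun singles =>
      (productLaw fun _ : Slot π.n => M.seedLaw).bind fun seeds =>
      (P ⟨pairs, singles, seeds⟩).bind fun r =>
      (spotLaw π.n π.k).bind fun spots =>
      (productLaw fun _ : Fin π.m => biasedLaw p N).bind fun points =>
      (productLaw fun _ : Fin π.m => M.seedLaw).bind fun freshSeeds =>
        PMF.pure ((verifierDecide M ε N π ⟨pairs, singles, seeds⟩ ⟨spots, points, freshSeeds⟩ r).run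
          fun q => train q.1 q.2) := by
  have h : interact train (spotCheckVerifier M p ε N π) P =
      (productLaw fun _ : Fin π.m => biasedLaw p N).bind fun points =>
      (productLaw fun s : Fin 3 × Fin π.n =>
        correlatedPairLaw p (![0, π.ρ, 2 * π.ρ] s.1) N).bind fun pairs =>
      (productLaw fun _ : Fin π.n => biasedLaw p N).bind fun singles =>
      (productLaw fun _ : Slot π.n => M.seedLaw).bind fun seeds =>
      (spotLaw π.n π.k).bind fun spots =>
      (productLaw fun _ : Fin π.m => M.seedLaw).bind fun freshSeeds =>
      (P ⟨pairs, singles, seeds⟩).bind fun r =>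
        PMF.pure ((verifierDecide M ε N π ⟨pairs, singles, seeds⟩ ⟨spots, points, freshSeeds⟩ r).run
          fun q => train q.1 q.2) := by
    simp only [interact, spotCheckVerifier, verifierCoins, PMF.bind_bind, ← PMF.bind_pure_comp,
      PMF.pure_bind, Function.comp_def]
  rw [h]
  refine (PMF.bind_comm _ _ _).trans (congrArg _ (funext fun pairs => ?_))
  refine (PMF.bind_comm _ _ _).trans (congrArg _ (funext fun singles => ?_))
  refine (PMF.bind_comm _ _ _).trans (congrArg _ (funext fun seeds => ?_))
  -- The reply depends on the challenge alone, so it commutes with the draws of spots and fresh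
  -- seeds.
  have h1 : ∀ points, ((spotLaw π.n π.k).bind fun spots =>
      (productLaw fun _ : Fin π.m => M.seedLaw).bind fun freshSeeds =>
      (P ⟨pairs, singles, seeds⟩).bind fun r =>
        PMF.pure ((verifierDecide M ε N π ⟨pairs, singles, seeds⟩ ⟨spots, points, freshSeeds⟩ r).run
          fun q => train q.1 q.2)) =
      (P ⟨pairs, singles, seeds⟩).bind fun r =>
      (spotLaw π.n π.k).bind fun spots =>
      (productLaw fun _ : Fin π.m => M.seedLaw).bind fun freshSeeds =>
        PMF.pure ((verifierDecide M ε N π ⟨pairs, singles, seeds⟩ ⟨spots, points, freshSeeds⟩ r).run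
          fun q => train q.1 q.2) := fun points =>
    (congrArg _ (funext fun spots => PMF.bind_comm _ _ _)).trans (PMF.bind_comm _ _ _)
  simp only [h1]
  refine (PMF.bind_comm _ _ _).trans (congrArg _ (funext fun r => ?_))
  exact PMF.bind_comm _ _ _

section Decide

variable (M : ModelClass Seed Θ b) (ε : ℝ) (π : Parameters) (c : Challenge N π.n Seed)
  (s : Secret N π.n π.m Seed) (r : Reply N π.n Θ) {f : Cube N → ℝ} {train : Cube N → Seed → Θ}

open Classical in
/-- The output of the verifier when all spot-checks pass. -/
def decision (f : Cube N → ℝ) : Option (Scores N) :=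
  if residualEstimate π.ρ π.n (fun t => M.output (r.models t)) + ε / 2 <
      (∑ j, (f (s.points j) - r.scores.predict (s.points j)) ^ 2) / π.m
    then none else some r.scores

/-- Accepted models have equal outputs and retraining reproduces `f`, so a wrong output in a checked
slot fails its check, whatever the seed. -/
theorem verifierDecide_eq_none (htrain : ∀ x r, M.output (train x r) = f x)
    (h : ∃ t ∈ s.spots, M.output (r.models t) ≠ f (c.subset t)) :
    ((verifierDecide M ε N π c s r).run fun q => train q.1 q.2).1 = none := by
  obtain ⟨t, ht, hne⟩ := h
  refine run_spotCheck_of_exists M c r.models _ _ _ ⟨t, Finset.mem_toList.2 ht, fun hc => hne ?_⟩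
  rw [← M.output_eq_of_checkEquiv _ _ hc, htrain]

theorem verifierDecide_eq_decision (htrain : ∀ x r, M.output (train x r) = f x)
    (h : ∀ t ∈ s.spots, M.checkEquiv (train (c.subset t) (c.seeds t)) (r.models t)) :
    ((verifierDecide M ε N π c s r).run fun q => train q.1 q.2).1 = decision M ε π s r f := by
  rw [verifierDecide, run_spotCheck_of_forall M c r.models _ _ _
    fun t ht => h t (Finset.mem_toList.1 ht), run_trainAll, decision]
  simp only [htrain]
  split_ifs <;> rfl

/-- Aborting never violates soundness, so it suffices to control `decision`, without knowing which
checks passed. -/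
theorem verifierDecide_eq_none_or (htrain : ∀ x r, M.output (train x r) = f x) :
    ((verifierDecide M ε N π c s r).run fun q => train q.1 q.2).1 = none ∨
      ((verifierDecide M ε N π c s r).run fun q => train q.1 q.2).1 = decision M ε π s r f := by
  by_cases h : ∀ t ∈ s.spots, M.checkEquiv (train (c.subset t) (c.seeds t)) (r.models t)
  · exact Or.inr (verifierDecide_eq_decision M ε π c s r htrain h)
  · push Not at h
    obtain ⟨t, ht, hne⟩ := h
    exact Or.inl (run_spotCheck_of_exists M c r.models _ _ _ ⟨t, Finset.mem_toList.2 ht, hne⟩)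

theorem verifierDecide_trainings_le :
    ((verifierDecide M ε N π c s r).run fun q => train q.1 q.2).2 ≤ s.spots.card + π.m := by
  classical
  refine (run_spotCheck_trainings_le M c r.models _ _ _).trans ?_
  rw [Finset.length_toList, run_trainAll]
  refine add_le_add le_rfl ?_
  simp only []
  split_ifs <;> simp [TrainingProgram.run]

end Decide

theorem expectedTrainings_le (M : ModelClass Seed Θ b) (p ε : ℝ) (π : Parameters)
    (train : Cube N → Seed → Θ) (P : Prover (Challenge N π.n Seed) (Reply N π.n Θ)) :
    expectedTrainings train (spotCheckVerifier M p ε N π) P ≤ ((π.k + π.m : ℕ) : ℝ≥0∞) := by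
  rw [expectedTrainings]
  set q := interact train (spotCheckVerifier M p ε N π) P with hq
  have hsupp : ∀ o ∈ q.support, o.2 ≤ π.k + π.m := by
    intro o ho
    rw [hq, interact_spotCheckVerifier_eq] at ho
    simp only [PMF.mem_support_bind_iff, PMF.mem_support_pure_iff] at ho
    obtain ⟨pairs, -, singles, -, seeds, -, r, -, spots, hspots, points, -, fresh, -, rfl⟩ := ho
    refine (verifierDecide_trainings_le M ε π _ _ r).trans (add_le_add ?_ le_rfl)
    rw [spotLaw, PMF.mem_support_uniformOfFinset_iff, Finset.mem_powersetCard] at hspots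
    exact hspots.2.trans_le (min_le_left _ _)
  calc ∑' o, q o * (o.2 : ℝ≥0∞) ≤ ∑' o, q o * ((π.k + π.m : ℕ) : ℝ≥0∞) := by
        refine ENNReal.tsum_le_tsum fun o => ?_
        by_cases ho : o ∈ q.support
        · exact mul_le_mul_right (by exact_mod_cast hsupp o ho) _
        · rw [(PMF.apply_eq_zero_iff q o).2 ho, zero_mul, zero_mul]
    _ = _ := by rw [ENNReal.tsum_mul_right, q.tsum_coe, one_mul]

end Interaction

/-! ### Completeness and soundness -/

/-- The tolerated error per noise level. -/
def levelTolerance (ε : ℝ) (π : Parameters) : ℝ := ε * π.ρ / 360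

/-- Conditions under which each of the deviation events has probability at most `exp (-L)`. -/
structure Adequate (p b ε L : ℝ) (π : Parameters) : Prop where
  rho_pos : 0 < π.ρ
  rho_le : π.ρ ≤ 1 / 2
  bias : 120 * b ^ 2 * π.ρ ^ 2 ≤ ε / 24
  n_pos : 0 < π.n
  m_pos : 0 < π.m
  n_large : L ≤ π.n * levelTolerance ε π ^ 2 / (2 * (2 * b ^ 2) ^ 2)
  k_large : L ≤ π.k * (levelTolerance ε π / (2 * b ^ 2)) / 7
  m_large_lower : L ≤ π.m * (ε ^ 2 / (32 * lossMomentConst p * (1 + b ^ 2) ^ 2))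
  m_large_upper : L ≤ π.m * (ε ^ 2 * lossExpRate p b ^ 2 / 768)

section Guarantees

variable {Seed Θ : Type*} {b p ε L : ℝ} {N : ℕ} {π : Parameters} {f : Cube N → ℝ}
  {train : Cube N → Seed → Θ}

theorem ofReal_exp_neg_le {x L : ℝ} (h : L ≤ x) :
    ENNReal.ofReal (Real.exp (-x)) ≤ ENNReal.ofReal (Real.exp (-L)) :=
  ENNReal.ofReal_le_ofReal (Real.exp_le_exp.2 (neg_le_neg h))

/-- The deviation event for the pairs of the challenge. -/
def badPairs (p ε : ℝ) (π : Parameters) (f : Cube N → ℝ) :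
    Set (Fin 3 × Fin π.n → Cube N × Cube N) :=
  ⋃ j : Fin 3, {x | π.n * levelTolerance ε π ≤ |∑ e : Fin π.n, f (x (j, e)).1 * f (x (j, e)).2 -
    π.n * expect (correlatedPairLaw p (![0, π.ρ, 2 * π.ρ] j) N) (fun q => f q.1 * f q.2)|}

/-- The deviation event for the single points of the challenge. -/
def badSingles (p ε : ℝ) (π : Parameters) (f : Cube N → ℝ) : Set (Fin π.n → Cube N) :=
  {x | π.n * levelTolerance ε π ≤ |∑ e : Fin π.n, f (x e) ^ 2 -
    π.n * expect (biasedLaw p N) (fun x => f x ^ 2)|}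

theorem Adequate.levelTolerance_pos (h : Adequate p b ε L π) (hε : 0 < ε) :
    0 < levelTolerance ε π := by
  have := h.rho_pos
  unfold levelTolerance; positivity

/-- Three noise levels with two tails each. -/
theorem badPairs_le (h : Adequate p b ε L π) (hb : 0 < b) (hε : 0 < ε)
    (hf : ∀ x, |f x| ≤ b) :
    (productLaw fun s : Fin 3 × Fin π.n =>
      correlatedPairLaw p (![0, π.ρ, 2 * π.ρ] s.1) N).toOuterMeasure (badPairs p ε π f) ≤
        6 * ENNReal.ofReal (Real.exp (-L)) := by
  have hj : ∀ j : Fin 3, (productLaw fun s : Fin 3 × Fin π.n =>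
      correlatedPairLaw p (![0, π.ρ, 2 * π.ρ] s.1) N).toOuterMeasure
      {x | π.n * levelTolerance ε π ≤ |∑ e : Fin π.n, f (x (j, e)).1 * f (x (j, e)).2 -
        π.n * expect (correlatedPairLaw p (![0, π.ρ, 2 * π.ρ] j) N) (fun q => f q.1 * f q.2)|} ≤
      2 * ENNReal.ofReal (Real.exp (-L)) := by
    intro j
    have h1 := hoeffding_two_sided (fun s : Fin 3 × Fin π.n =>
      correlatedPairLaw p (![0, π.ρ, 2 * π.ρ] s.1) N) ({j} ×ˢ Finset.univ)
      (fun q => f q.1 * f q.2) (D := 2 * b ^ 2) (τ := levelTolerance ε π)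
      (e := expect (correlatedPairLaw p (![0, π.ρ, 2 * π.ρ] j) N) fun q => f q.1 * f q.2)
      (by positivity) (h.levelTolerance_pos hε).le
      (fun q q' => abs_mul_sub_mul_le (hf _) (hf _) (hf _) (hf _)) (fun i hi => by
        rw [Finset.mem_product, Finset.mem_singleton] at hi
        rw [hi.1])
    simp only [Finset.card_product, Finset.card_singleton, Finset.card_univ, Fintype.card_fin,
      one_mul, Finset.sum_product, Finset.sum_singleton] at h1
    exact h1.trans (mul_le_mul_right (ofReal_exp_neg_le h.n_large) _)
  refine (MeasureTheory.measure_iUnion_le _).trans ?_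
  rw [tsum_fintype]
  refine (Finset.sum_le_sum fun j _ => hj j).trans (le_of_eq ?_)
  rw [Finset.sum_const, Finset.card_univ, Fintype.card_fin, nsmul_eq_mul, ← mul_assoc]
  norm_num

theorem badSingles_le (h : Adequate p b ε L π) (hb : 0 < b) (hε : 0 < ε)
    (hf : ∀ x, |f x| ≤ b) :
    (productLaw fun _ : Fin π.n => biasedLaw p N).toOuterMeasure (badSingles p ε π f) ≤
        2 * ENNReal.ofReal (Real.exp (-L)) := by
  have h1 := hoeffding_two_sided (fun _ : Fin π.n => biasedLaw p N) Finset.univ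
    (fun x => f x ^ 2) (D := 2 * b ^ 2) (τ := levelTolerance ε π)
    (e := expect (biasedLaw p N) fun x => f x ^ 2)
    (by positivity) (h.levelTolerance_pos hε).le
    (fun q q' => by rw [sq, sq]; exact abs_mul_sub_mul_le (hf _) (hf _) (hf _) (hf _))
    (fun i _ => rfl)
  simp only [Finset.card_univ, Fintype.card_fin] at h1
  exact h1.trans (mul_le_mul_right (ofReal_exp_neg_le h.n_large) _)

open Classical in
theorem abs_residualEstimate_sub_le_of_good (hp0 : 0 < p) (hp1 : p < 1)
    (h : Adequate p b ε L π) (hε : 0 < ε) (hf : ∀ x, f x ∈ Set.Icc (-b) b)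
    {c : Challenge N π.n Seed} (hpairs : c.pairs ∉ badPairs p ε π f)
    (hsingles : c.singles ∉ badSingles p ε π f) {v : Slot π.n → ℝ} (hv : ∀ t, |v t| ≤ b)
    (hbad : 2 * b ^ 2 * (Finset.univ.filter fun t => v t ≠ f (c.subset t)).card ≤
      π.n * levelTolerance ε π) :
    |residualEstimate π.ρ π.n v - residual p f| ≤ ε / 4 := by
  refine abs_residualEstimate_sub_le (u := fun t => f (c.subset t)) hp0 hp1 hf hε h.rho_pos
    h.rho_le h.bias rfl h.n_pos (fun t => abs_le.2 (hf _)) hv (fun j => ?_) ?_ hbad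
  · simp only [badPairs, Set.mem_iUnion, not_exists] at hpairs
    exact (not_le.1 (hpairs j)).le
  · exact (not_le.1 hsingles).le

theorem toOuterMeasure_pure_eq_zero {α : Type*} {a : α} {s : Set α} (h : a ∉ s) :
    (PMF.pure a).toOuterMeasure s ≤ 0 := by
  classical
  rw [PMF.toOuterMeasure_pure_apply, if_neg h]

/-- Once challenge and reply are fixed there is a dichotomy: few wrong slots leave the residual
estimate accurate, many are caught. Only one of the two last failure probabilities is paid, giving
`6 + 2 + 1`. -/
theorem soundness_error_le (hb : 0 < b) (hp0 : 0 < p) (hp1 : p < 1) (hε0 : 0 < ε) (hε1 : ε ≤ 1)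
    (h : Adequate p b ε L π) (hf : ∀ x, f x ∈ Set.Icc (-b) b) (M : ModelClass Seed Θ b)
    (htrain : ∀ x r, M.output (train x r) = f x)
    (P : Prover (Challenge N π.n Seed) (Reply N π.n Θ)) :
    (interact train (spotCheckVerifier M p ε N π) P).toOuterMeasure
      {o | ∃ a, o.1 = some a ∧ ε < err p f a} ≤ 9 * ENNReal.ofReal (Real.exp (-L)) := by
  classical
  set η := ENNReal.ofReal (Real.exp (-L)) with hη
  have hf' : ∀ x, |f x| ≤ b := fun x => abs_le.2 (hf x)
  rw [interact_spotCheckVerifier_eq, show 9 * η = 6 * η + (2 * η + η) by ring]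
  refine toOuterMeasure_bind_le_add _ _ _ _ (badPairs_le h hb hε0 hf') fun pairs hpairs =>
    toOuterMeasure_bind_le_add _ _ _ _ (badSingles_le h hb hε0 hf') fun singles hsingles =>
    toOuterMeasure_bind_le _ _ _ fun seeds => toOuterMeasure_bind_le _ _ _ fun r => ?_
  set c : Challenge N π.n Seed := ⟨pairs, singles, seeds⟩ with hc
  set B := Finset.univ.filter fun t => M.output (r.models t) ≠ f (c.subset t) with hB
  by_cases hbad : 2 * b ^ 2 * B.card ≤ π.n * levelTolerance ε π
  · refine toOuterMeasure_bind_le _ _ _ fun spots => ?_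
    by_cases herr : ε < err p f r.scores
    · have htail := empirical_loss_lower_tail hp0 hp1 hb hf r.scores π.m hε0 hε1 herr.le
      rw [← add_zero η]
      refine toOuterMeasure_bind_le_add _ _ _ _
        (htail.trans (ofReal_exp_neg_le h.m_large_lower)) fun points hpoints =>
        toOuterMeasure_bind_le _ _ _ fun fresh => toOuterMeasure_pure_eq_zero ?_
      rintro ⟨a, ha, -⟩
      rcases verifierDecide_eq_none_or M ε π c ⟨spots, points, fresh⟩ r htrain with hd | hd
      · rw [hd] at ha; cases ha
      · rw [hd, decision, if_pos] at ha
        · cases ha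
        have hm : (0 : ℝ) < π.m := by exact_mod_cast h.m_pos
        have hres := abs_le.1 (abs_residualEstimate_sub_le_of_good hp0 hp1 h hε0 hf (c := c)
          hpairs hsingles (fun t => abs_le.2 (M.output_mem (r.models t))) hbad)
        have hpt := hpoints
        rw [Set.mem_ofPred_eq, not_le] at hpt
        -- The threshold is at most `residual + ε/4 + ε/2`, which is below `residual + 3/4 err`.
        rw [lt_div_iff₀' hm]
        refine lt_of_le_of_lt (mul_le_mul_of_nonneg_left ?_ hm.le) hpt
        linarith [hres.2]
    · refine le_trans ?_ zero_le
      refine toOuterMeasure_bind_le _ _ _ fun points => toOuterMeasure_bind_le _ _ _ fun fresh =>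
        toOuterMeasure_pure_eq_zero ?_
      rintro ⟨a, ha, ha'⟩
      rcases verifierDecide_eq_none_or M ε π c ⟨spots, points, fresh⟩ r htrain with hd | hd
      · rw [hd] at ha; cases ha
      · rw [hd, decision] at ha
        split_ifs at ha
        cases ha
        exact herr ha'
  · have hspot := spotLaw_disjoint_le h.n_pos π.k B
    have hn : (0 : ℝ) < π.n := by exact_mod_cast h.n_pos
    have hL : L ≤ π.k * B.card / (7 * π.n) := by
      refine h.k_large.trans ?_
      have h1 : levelTolerance ε π / (2 * b ^ 2) ≤ B.card / π.n := by
        rw [div_le_div_iff₀ (by positivity) hn]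
        linarith [not_le.1 hbad]
      calc π.k * (levelTolerance ε π / (2 * b ^ 2)) / 7 ≤ π.k * (B.card / π.n) / 7 := by gcongr
        _ = _ := by field_simp
    rw [← add_zero η]
    refine toOuterMeasure_bind_le_add _ _ _ _ (hspot.trans (ofReal_exp_neg_le hL))
      fun spots hspots => toOuterMeasure_bind_le _ _ _ fun points =>
      toOuterMeasure_bind_le _ _ _ fun fresh => toOuterMeasure_pure_eq_zero ?_
    rintro ⟨a, ha, -⟩
    obtain ⟨t, ht, htB⟩ := Finset.not_disjoint_iff.1 hspots
    rw [verifierDecide_eq_none M ε π c ⟨spots, points, fresh⟩ r htrain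
      ⟨t, ht, (Finset.mem_filter.1 htB).2⟩] at ha
    cases ha

theorem completeness_error_le (hb : 0 < b) (hp0 : 0 < p) (hp1 : p < 1) (hε0 : 0 < ε) (hε1 : ε ≤ 1)
    (h : Adequate p b ε L π) (hf : ∀ x, f x ∈ Set.Icc (-b) b) (M : ModelClass Seed Θ b)
    (htrain : ∀ x r, M.output (train x r) = f x) :
    (interact train (spotCheckVerifier M p ε N π) (honestProver p π.n f train)).toOuterMeasure
      {o | ∃ a, o.1 = some a ∧ err p f a ≤ ε}ᶜ ≤ 9 * ENNReal.ofReal (Real.exp (-L)) := by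
  classical
  set η := ENNReal.ofReal (Real.exp (-L)) with hη
  have hf' : ∀ x, |f x| ≤ b := fun x => abs_le.2 (hf x)
  rw [interact_spotCheckVerifier_eq, show 9 * η = 6 * η + (2 * η + (η + 0)) by ring]
  refine toOuterMeasure_bind_le_add _ _ _ _ (badPairs_le h hb hε0 hf') fun pairs hpairs =>
    toOuterMeasure_bind_le_add _ _ _ _ (badSingles_le h hb hε0 hf') fun singles hsingles =>
    toOuterMeasure_bind_le _ _ _ fun seeds => ?_
  rw [honestProver, PMF.pure_bind]
  set c : Challenge N π.n Seed := ⟨pairs, singles, seeds⟩ with hc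
  refine toOuterMeasure_bind_le _ _ _ fun spots => toOuterMeasure_bind_le_add _ _ _ _
    ((empirical_optimal_loss_upper_tail hp0 hp1 hb hf π.m hε0 hε1).trans
      (ofReal_exp_neg_le h.m_large_upper)) fun points hpoints =>
    toOuterMeasure_bind_le _ _ _ fun fresh => toOuterMeasure_pure_eq_zero ?_
  rw [Set.notMem_compl_iff]
  refine ⟨optimalScores p f, ?_, (err_optimalScores f).trans_le hε0.le⟩
  -- Honest models come from the same subsets and seeds as the retraining, so reflexivity passes
  -- every check.
  rw [verifierDecide_eq_decision M ε π c _ _ htrain fun t _ => M.checkEquiv_refl _, decision,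
    if_neg]
  have hm : (0 : ℝ) < π.m := by exact_mod_cast h.m_pos
  have hres := abs_le.1 (abs_residualEstimate_sub_le_of_good hp0 hp1 h hε0 hf (c := c)
    hpairs hsingles (v := fun t => M.output (train (c.subset t) (c.seeds t)))
    (fun t => abs_le.2 (M.output_mem _)) (by
      have := h.levelTolerance_pos hε0
      simp only [htrain, ne_eq, not_true_eq_false, Finset.filter_false, Finset.card_empty,
        Nat.cast_zero, mul_zero]
      positivity))
  have hpt := hpoints
  rw [Set.mem_ofPred_eq, not_le] at hpt
  rw [not_lt, div_le_iff₀' hm]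
  refine hpt.le.trans (mul_le_mul_of_nonneg_left ?_ hm.le)
  linarith [hres.1]

end Guarantees

/-! ### Choice of the parameters -/

/-- The constant in the noise level. -/
def noiseConst (b : ℝ) : ℝ := 1 / (60 * (b + 1))

/-- The constant in the number of samples for the residual estimate. -/
def sampleConst (b : ℝ) : ℝ := 16 * 129600 * b ^ 4 / noiseConst b ^ 2

/-- The constant in the number of spot-checks. -/
def spotConst (b : ℝ) : ℝ := 10080 * b ^ 2 / noiseConst b

/-- The constant in the number of samples for the error estimate. -/
def lossConst (p b : ℝ) : ℝ :=
  64 * lossMomentConst p * (1 + b ^ 2) ^ 2 + 1536 / lossExpRate p b ^ 2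

section

variable {b p : ℝ}

theorem noiseConst_pos (hb : 0 < b) : 0 < noiseConst b := by unfold noiseConst; positivity

theorem noiseConst_le (hb : 0 < b) : noiseConst b ≤ 1 / 60 := by
  unfold noiseConst
  gcongr
  linarith

theorem sampleConst_pos (hb : 0 < b) : 0 < sampleConst b := by
  have := noiseConst_pos hb
  unfold sampleConst; positivity

theorem spotConst_pos (hb : 0 < b) : 0 < spotConst b := by
  have := noiseConst_pos hb
  unfold spotConst; positivity

theorem lossConst_pos (hp0 : 0 < p) (hp1 : p < 1) (b : ℝ) : 0 < lossConst p b := by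
  have := lossExpRate_pos hp0 hp1 b
  have := lossMomentConst_pos hp0 hp1
  unfold lossConst; positivity

/-- The `4` keeps the logarithm away from zero as `δ` tends to `1`, so that rounding up can be
absorbed. -/
theorem one_le_log_four_div {δ : ℝ} (hδ0 : 0 < δ) (hδ1 : δ ≤ 1) : 1 ≤ Real.log (4 / δ) := by
  rw [Real.le_log_iff_exp_le (by positivity)]
  refine (Real.exp_one_lt_d9.le.trans (by norm_num : _ ≤ (4 : ℝ))).trans ?_
  rw [le_div_iff₀ hδ0]
  linarith

theorem adequate_parameters (hb : 0 < b) (hp0 : 0 < p) (hp1 : p < 1) {ε δ : ℝ} (hε0 : 0 < ε)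
    (hε1 : ε ≤ 1) (hδ0 : 0 < δ) (hδ1 : δ ≤ 1) :
    Adequate p b ε (2 * Real.log (4 / δ))
      (parameters (noiseConst b) (sampleConst b) (spotConst b) (lossConst p b) ε δ) := by
  have hc := noiseConst_pos hb
  have hc' := noiseConst_le hb
  have hL : 0 < Real.log (4 / δ) := one_pos.trans_le (one_le_log_four_div hδ0 hδ1)
  have hs := sampleConst_pos hb
  have hk := spotConst_pos hb
  have hm := lossConst_pos hp0 hp1 b
  have hA := lossMomentConst_pos hp0 hp1
  have hl := lossExpRate_pos hp0 hp1 b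
  set L := Real.log (4 / δ) with hLdef
  have hsq : √ε ^ 2 = ε := Real.sq_sqrt hε0.le
  have hsq0 : 0 < √ε := Real.sqrt_pos.2 hε0
  have hsq1 : √ε ≤ 1 := Real.sqrt_le_one.2 hε1
  have hsqε : ε ≤ √ε := by nlinarith
  have hbc : b ^ 2 * noiseConst b ^ 2 ≤ 1 / 3600 := by
    have h1 : b * noiseConst b ≤ 1 / 60 := by
      unfold noiseConst
      rw [mul_one_div, div_le_div_iff₀ (by positivity) (by norm_num)]
      linarith
    rw [← mul_pow]
    calc (b * noiseConst b) ^ 2 ≤ (1 / 60) ^ 2 := by gcongr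
      _ = _ := by norm_num
  have hmle : lossConst p b * L / ε ^ 2 ≤
      ((parameters (noiseConst b) (sampleConst b) (spotConst b) (lossConst p b) ε δ).m : ℝ) :=
    Nat.le_ceil _
  have htol : levelTolerance ε (parameters (noiseConst b) (sampleConst b) (spotConst b)
      (lossConst p b) ε δ) = ε * (noiseConst b * √ε) / 360 := rfl
  refine ⟨mul_pos hc hsq0, ?_, ?_, ?_, ?_, ?_, ?_, ?_, ?_⟩
  · have : noiseConst b * √ε ≤ noiseConst b * 1 := by gcongr
    simp only [parameters]
    linarith
  · simp only [parameters]
    rw [mul_pow, hsq]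
    nlinarith
  · exact Nat.ceil_pos.2 (by positivity)
  · exact Nat.ceil_pos.2 (by positivity)
  · have hn : sampleConst b * L / ε ^ 3 ≤ ((parameters (noiseConst b) (sampleConst b) (spotConst b)
      (lossConst p b) ε δ).n : ℝ) := Nat.le_ceil _
    rw [htol]
    have hτ : (ε * (noiseConst b * √ε) / 360) ^ 2 = ε ^ 3 * noiseConst b ^ 2 / 129600 := by
      rw [div_pow, mul_pow, mul_pow, hsq]; ring
    rw [hτ]
    refine le_trans (le_of_eq ?_) (div_le_div_of_nonneg_right
      (mul_le_mul_of_nonneg_right hn (by positivity)) (by positivity))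
    unfold sampleConst
    field_simp
    norm_num
  · have hn : spotConst b * L / ε ^ 2 ≤ ((parameters (noiseConst b) (sampleConst b) (spotConst b)
      (lossConst p b) ε δ).k : ℝ) := Nat.le_ceil _
    rw [htol]
    -- Spot-checks of order `ε^(-3/2)` would suffice; `ε ≤ √ε` weakens this to `ε⁻²`.
    have h1 : ε ^ 2 * noiseConst b / 360 ≤ ε * (noiseConst b * √ε) / 360 := by
      have : ε * noiseConst b * ε ≤ ε * noiseConst b * √ε := by gcongr
      linarith
    calc 2 * L = (spotConst b * L / ε ^ 2) * ((ε ^ 2 * noiseConst b / 360) / (2 * b ^ 2)) / 7 := by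
          unfold spotConst
          field_simp
          norm_num
      _ ≤ _ := by gcongr
  · calc 2 * L = (64 * lossMomentConst p * (1 + b ^ 2) ^ 2 * L / ε ^ 2) *
          (ε ^ 2 / (32 * lossMomentConst p * (1 + b ^ 2) ^ 2)) := by field_simp; norm_num
      _ ≤ (lossConst p b * L / ε ^ 2) * (ε ^ 2 / (32 * lossMomentConst p * (1 + b ^ 2) ^ 2)) := by
          unfold lossConst
          gcongr
          exact le_add_of_nonneg_right (by positivity)
      _ ≤ _ := by gcongr
  · calc 2 * L = (1536 / lossExpRate p b ^ 2 * L / ε ^ 2) *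
          (ε ^ 2 * lossExpRate p b ^ 2 / 768) := by field_simp; norm_num
      _ ≤ (lossConst p b * L / ε ^ 2) * (ε ^ 2 * lossExpRate p b ^ 2 / 768) := by
          unfold lossConst
          gcongr
          exact le_add_of_nonneg_left (by positivity)
      _ ≤ _ := by gcongr

/-- The factor `2` in the exponent makes each failure probability `δ² / 16`, so nine of them fit
into `δ`. -/
theorem nine_mul_exp_neg_le {δ : ℝ} (hδ0 : 0 < δ) (hδ1 : δ ≤ 1) :
    9 * ENNReal.ofReal (Real.exp (-(2 * Real.log (4 / δ)))) ≤ ENNReal.ofReal δ := by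
  have h : Real.exp (-(2 * Real.log (4 / δ))) = (δ / 4) ^ 2 := by
    rw [← mul_neg, mul_comm, Real.exp_mul, Real.exp_neg, Real.exp_log (by positivity), inv_div]
    norm_num
  rw [h, show (9 : ℝ≥0∞) = ENNReal.ofReal 9 by simp, ← ENNReal.ofReal_mul (by norm_num)]
  refine ENNReal.ofReal_le_ofReal ?_
  nlinarith

theorem cost_le {cC cM ε L : ℝ} (hC : 0 ≤ cC) (hM : 0 ≤ cM) (hε0 : 0 < ε) (hε1 : ε ≤ 1)
    (hL : 1 ≤ L) :
    (⌈cC * L / ε ^ 2⌉₊ : ℝ) + ⌈cM * L / ε ^ 2⌉₊ ≤ (cC + cM + 2) * L / ε ^ 2 := by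
  have h1 := Nat.ceil_lt_add_one (a := cC * L / ε ^ 2) (by positivity)
  have h2 := Nat.ceil_lt_add_one (a := cM * L / ε ^ 2) (by positivity)
  have h3 : 1 ≤ L / ε ^ 2 := by
    rw [one_le_div (by positivity)]
    nlinarith
  have h4 : (cC + cM + 2) * L / ε ^ 2 = cC * L / ε ^ 2 + cM * L / ε ^ 2 + 2 * (L / ε ^ 2) := by
    ring
  linarith

theorem log_four_div_le {δ : ℝ} (hδ0 : 0 < δ) (hδ : δ ≤ 1 / 2) :
    Real.log (4 / δ) ≤ 3 * Real.log (1 / δ) := by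
  have h : Real.log 2 ≤ Real.log (1 / δ) := by
    refine Real.log_le_log two_pos ?_
    rw [le_div_iff₀ hδ0]
    linarith
  have h4 : Real.log (4 / δ) = 2 * Real.log 2 + Real.log (1 / δ) := by
    rw [show (4 : ℝ) / δ = 2 ^ 2 * (1 / δ) by ring, Real.log_mul (by norm_num) (by positivity),
      Real.log_pow]
    norm_num
  linarith

/-- The base `l / ε` is at least `2 log 2 > 1.3`, so constants are absorbed by extra powers; `1 ≤ 2
l` trades the single factor `l` for `l²`. -/
theorem exists_pow_bound (C : ℝ) : ∃ k : ℕ, 0 < k ∧ ∀ ε l : ℝ, 0 < ε → ε ≤ 1 / 2 →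
    Real.log 2 ≤ l → C * l / ε ^ 2 < (1 / ε * l) ^ k := by
  obtain ⟨j, hj⟩ := pow_unbounded_of_one_lt (2 * |C|) (by norm_num : (1 : ℝ) < 1.3)
  refine ⟨j + 2, by omega, fun ε l hε0 hε hl => ?_⟩
  have hlog := Real.log_two_gt_d9
  have hl0 : 0 < l := by linarith
  set x := 1 / ε * l with hx
  have hx1 : 1.3 ≤ x := by
    rw [hx, one_div_mul_eq_div, le_div_iff₀ hε0]
    linarith
  have h1 : C * l / ε ^ 2 ≤ 2 * |C| * x ^ 2 := by
    have h2 : 2 * |C| * x ^ 2 = |C| * (2 * l) * l / ε ^ 2 := by rw [hx]; field_simp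
    rw [h2]
    gcongr
    calc C ≤ |C| * 1 := by rw [mul_one]; exact le_abs_self C
      _ ≤ |C| * (2 * l) := by gcongr; linarith
  calc C * l / ε ^ 2 ≤ 2 * |C| * x ^ 2 := h1
    _ < 1.3 ^ j * x ^ 2 := by gcongr
    _ ≤ x ^ j * x ^ 2 := by gcongr
    _ = _ := by rw [pow_add]

end

end Attribution

end

theorem theorem1 (b : ℝ) (hb : 0 < b) (p : ℝ) (hp0 : 0 < p) (hp1 : p < 1) :
    ∃ (cρ cE cC cM : ℝ) (κ : ℝ → ℝ → ℕ),
      (0 < cρ ∧ cρ ≤ 1 / 2 ∧ 0 < cE ∧ 0 < cC ∧ 0 < cM) ∧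
      -- completeness, soundness and cost at most `κ`, for all data sets and training procedures
      (∀ (ε δ : ℝ), 0 < ε → ε < 1 → 0 < δ → δ < 1 →
        ∀ (N : ℕ) (f : Attribution.Cube N → ℝ), (∀ x, f x ∈ Set.Icc (-b) b) →
        ∀ (Seed : Type*) (Θ : Type*) (M : Attribution.ModelClass Seed Θ b)
          (train : Attribution.Cube N → Seed → Θ), (∀ x r, M.output (train x r) = f x) →
          Attribution.IsOptimal p f (Attribution.optimalScores p f) ∧
          Attribution.IsPACVerifier p ε δ κ f train
            (Attribution.spotCheckVerifier M p ε N (Attribution.parameters cρ cE cC cM ε δ))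
            (Attribution.honestProver p (Attribution.parameters cρ cE cC cM ε δ).n f train)) ∧
      -- the cost is `O(log(1/δ)/ε²)`
      (∃ C : ℝ, ∀ ε δ : ℝ, 0 < ε → ε < 1 → 0 < δ → δ < 1 →
        (κ ε δ : ℝ) ≤ C * Real.log (4 / δ) / ε ^ 2 ∧
        (δ ≤ 1 / 2 → (κ ε δ : ℝ) ≤ C * Real.log (1 / δ) / ε ^ 2)) ∧
      -- the cost is polynomial in `log(1/δ)/ε`
      (∃ k : ℕ, 0 < k ∧ ∀ ε δ : ℝ, 0 < ε → ε ≤ 1 / 2 → 0 < δ → δ ≤ 1 / 2 →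
        (κ ε δ : ℝ) < (1 / ε * Real.log (1 / δ)) ^ k) := by
  have hsp := Attribution.spotConst_pos hb
  have hlo := Attribution.lossConst_pos hp0 hp1 b
  set C := Attribution.spotConst b + Attribution.lossConst p b + 2 with hC
  have hC0 : 0 < C := by positivity
  have hκ : ∀ ε δ : ℝ, 0 < ε → ε < 1 → 0 < δ → δ < 1 →
      ((⌈Attribution.spotConst b * Real.log (4 / δ) / ε ^ 2⌉₊ +
        ⌈Attribution.lossConst p b * Real.log (4 / δ) / ε ^ 2⌉₊ : ℕ) : ℝ) ≤
        C * Real.log (4 / δ) / ε ^ 2 := fun ε δ hε0 hε1 hδ0 hδ1 => by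
    rw [Nat.cast_add]
    exact Attribution.cost_le hsp.le hlo.le hε0 hε1.le (Attribution.one_le_log_four_div hδ0 hδ1.le)
  have hκ' : ∀ ε δ : ℝ, 0 < ε → ε < 1 → 0 < δ → δ ≤ 1 / 2 →
      ((⌈Attribution.spotConst b * Real.log (4 / δ) / ε ^ 2⌉₊ +
        ⌈Attribution.lossConst p b * Real.log (4 / δ) / ε ^ 2⌉₊ : ℕ) : ℝ) ≤
        3 * C * Real.log (1 / δ) / ε ^ 2 := fun ε δ hε0 hε1 hδ0 hδ1 => by
    refine (hκ ε δ hε0 hε1 hδ0 (by linarith)).trans ?_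
    have := Attribution.log_four_div_le hδ0 hδ1
    rw [mul_comm 3 C, mul_assoc]
    gcongr
  -- The cost function is the worst case `k + m`. The constant `3 * C` serves both bounds, the
  -- factor `3` coming from `log (4/δ) ≤ 3 log (1/δ)`.
  refine ⟨Attribution.noiseConst b, Attribution.sampleConst b, Attribution.spotConst b,
    Attribution.lossConst p b, fun ε δ => ⌈Attribution.spotConst b * Real.log (4 / δ) / ε ^ 2⌉₊ +
      ⌈Attribution.lossConst p b * Real.log (4 / δ) / ε ^ 2⌉₊,
    ⟨Attribution.noiseConst_pos hb, (Attribution.noiseConst_le hb).trans (by norm_num),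
      Attribution.sampleConst_pos hb, hsp, hlo⟩, ?_, ⟨3 * C, ?_⟩, ?_⟩
  · intro ε δ hε0 hε1 hδ0 hδ1 N f hf Seed Θ M train htrain
    have had := Attribution.adequate_parameters hb hp0 hp1 hε0 hε1.le hδ0 hδ1.le
    refine ⟨Attribution.isOptimal_optimalScores hp0 hp1 f, ?_, fun P => ?_, fun P => ?_⟩
    · exact Attribution.ofReal_one_sub_le_toOuterMeasure _ _ hδ0.le
        ((Attribution.completeness_error_le hb hp0 hp1 hε0 hε1.le had hf M htrain).trans
          (Attribution.nine_mul_exp_neg_le hδ0 hδ1.le))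
    · exact (Attribution.soundness_error_le hb hp0 hp1 hε0 hε1.le had hf M htrain P).trans
        (Attribution.nine_mul_exp_neg_le hδ0 hδ1.le)
    · exact Attribution.expectedTrainings_le M p ε _ train P
  · intro ε δ hε0 hε1 hδ0 hδ1
    refine ⟨(hκ ε δ hε0 hε1 hδ0 hδ1).trans ?_, hκ' ε δ hε0 hε1 hδ0⟩
    have := Attribution.one_le_log_four_div hδ0 hδ1.le
    gcongr
    linarith
  · obtain ⟨k, hk0, hk⟩ := Attribution.exists_pow_bound (3 * C)
    refine ⟨k, hk0, fun ε δ hε0 hε hδ0 hδ => (hκ' ε δ hε0 (by linarith) hδ0 hδ).trans_lt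
      (hk ε _ hε0 hε ?_)⟩
    refine Real.log_le_log two_pos ?_
    rw [le_div_iff₀ hδ0]
    linarith
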